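/- Let $G$ be a finitely generated group that is amenable (there is a finitely additive left-invariant probability measure on all subsets of $G$) and has finite Assouad--Nagata dimension with respect to word metrics. The latter means: for some (equivalently, every) finite symmetric generating set $T$ there are an integer $d\ge 0$ and $K\ge 1$ such that for every $r>1$ there is a partition of $(G,d_T)$ whose pieces are coloured with $d+1$ colours, have diameter at most $Kr$, and are such that any two distinct pieces of the same colour are at distance greater than $r$. Let $S$ be any finite symmetric generating set of $G$, with word length $l_S$ and balls $B(e,r)=\{g: l_S(g)\le r\}$. Let $\mu$ be any symmetric probability measure on $G$ whose support is finite and generates $G$, and let $(W_n)_{n\ge 0}$ be the (simple) random walk with $W_0=e$ and independent right increments of law $\mu$; put $p_n(e,e)=\mathbb P(W_n=e)$. Then: 1. For every $p\in[1,2]$ there is a constant $C$ such that for all real $r>0$ $$\lambda_{S,p}(B(e,r)) := \inf\Big\{\tfrac12\sum_{x,y\in G}|f(x)-f(xy)|^p\mu(y)\;:\; f\colon G\to\mathbb R,\ \operatorname{supp} f\subseteq B(e,r),\ \|f\|_p=1\Big\}\le C r^{-p}.$$ 2. The walk is totally cautious: for every $\varepsilon>0$ there is $p_\varepsilon>0$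 such that $$\mathbb P\Big(\max_{1\le k\le n} l_S(W_k)\le \varepsilon\sqrt n\Big)\ge p_\varepsilon$$ for all $n\ge 1$ with $\varepsilon\sqrt n\ge \min\{l_S(g): g\in\operatorname{supp}\mu\}$ (for the remaining $n$, which are finitely many, and none if $\mu(e)>0$, this probability is $0$). 3. The return probability is large: there is a constant $C$ such that $p_n(e,e)\ge \exp(-C n^{1/3})$ for all even $n\geq 0$, and also for all odd $n$ with $p_n(e,e)>0$. 4. The walk is diffusive: there is $C>0$ such that $\mathbb E\, l_S(W_n)\le C\sqrt n$ for all $n\ge 0$. -/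

import Mathlib

open MeasureTheory
open scoped ENNReal

noncomputable section

namespace ANGroup

/-! ### Amenability and word metrics -/

/-- `G` is amenable: there is a finitely additive, left-invariant probability measure defined on
all subsets of `G`. -/
def IsAmenable (G : Type*) [Group G] : Prop :=
  ∃ m : Set G → ℝ,
    (∀ A, 0 ≤ m A) ∧ m Set.univ = 1 ∧
    (∀ A B, Disjoint A B → m (A ∪ B) = m A + m B) ∧
    ∀ (g : G) (A : Set G), m ((fun x => g * x) '' A) = m A

/-- `S` is a (finite) symmetric generating set of `G`. -/
structure IsSymmGenerating {G : Type*} [Group G] (S : Finset G) : Prop where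
  inv_mem : ∀ s ∈ S, s⁻¹ ∈ S
  closure_eq_top : Subgroup.closure (S : Set G) = ⊤

/-- The word length `l_S(g)`: the least `n` such that `g` is a product of `n` elements of `S`
(used for symmetric generating sets `S` only, for which such an `n` exists). -/
def wordLength {G : Type*} [Group G] (S : Finset G) (g : G) : ℕ :=
  sInf {n | ∃ w : List G, (∀ s ∈ w, s ∈ S) ∧ w.length = n ∧ w.prod = g}

/-- The word metric `d_S(h, g) = l_S(h⁻¹ g)`. -/
def wordDist {G : Type*} [Group G] (S : Finset G) (h g : G) : ℝ :=
  wordLength S (h⁻¹ * g)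

/-- The closed ball `B(e, r)` of the word metric. -/
def ball {G : Type*} [Group G] (S : Finset G) (r : ℝ) : Set G :=
  {g | (wordLength S g : ℝ) ≤ r}

/-! ### Assouad-Nagata dimension -/

/-- The metric space `(M, dist)` has Assouad-Nagata dimension at most `d`: for some `K ≥ 1` and
every `r > 1` there are a partition `P` of `M` and a colouring of its pieces by `d + 1` colours
such that all pieces have diameter at most `K r` and distinct pieces of the same colour are at
distance greater than `r` (the distance of two sets being the infimum of the distances between
their points). -/
def ANDimLE {M : Type*} (dist : M → M → ℝ) (d : ℕ) : Prop :=
  ∃ K : ℝ, 1 ≤ K ∧ ∀ r : ℝ, 1 < r →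
    ∃ (P : Set (Set M)) (colour : Set M → Fin (d + 1)),
      Setoid.IsPartition P ∧
      (∀ A ∈ P, ∀ x ∈ A, ∀ y ∈ A, dist x y ≤ K * r) ∧
      ∀ A ∈ P, ∀ B ∈ P, A ≠ B → colour A = colour B →
        ∃ r' : ℝ, r < r' ∧ ∀ x ∈ A, ∀ y ∈ B, r' ≤ dist x y

/-- `G` is a finitely generated group of finite Assouad-Nagata dimension: with respect to the word
metric of some finite symmetric generating set, the Assouad-Nagata dimension of `G` is at most `d`
for some natural number `d`. (Word metrics of different finite generating sets are bi-Lipschitz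
equivalent, so "some" and "every" amount to the same here.) -/
def HasFiniteANDim (G : Type*) [Group G] : Prop :=
  ∃ T : Finset G, IsSymmGenerating T ∧ ∃ d : ℕ, ANDimLE (wordDist T) d

/-! ### Random walks -/

/-- The random walk with step distribution `μ` is simple: `μ` is symmetric, and its support is
finite and generates `G`. -/
structure IsSimpleWalk {G : Type*} [Group G] (μ : PMF G) : Prop where
  symm : ∀ g, μ g⁻¹ = μ g
  finite_support : μ.support.Finite
  closure_support : Subgroup.closure μ.support = ⊤

/-- The position `W_n` of the walk with increments `ω 0, ω 1, …` started at the identity. -/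
def position {G : Type*} [Group G] (ω : ℕ → G) : ℕ → G
  | 0 => 1
  | n + 1 => position ω n * ω n

/-- The law of the sequence of increments: independent, each with distribution `μ`. -/
def incrementLaw {G : Type*} [MeasurableSpace G] (μ : PMF G) : Measure (ℕ → G) :=
  Measure.infinitePi fun _ : ℕ => μ.toMeasure

/-- The return probability `p_n(e, e) = P(W_n = e)`. -/
def returnProb {G : Type*} [Group G] [MeasurableSpace G] (μ : PMF G) (n : ℕ) : ℝ :=
  (incrementLaw μ).real {ω | position ω n = 1}

/-- The drift function `L(n) = E[l_S(W_n)]`. -/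
def drift {G : Type*} [Group G] [MeasurableSpace G] (S : Finset G) (μ : PMF G) (n : ℕ) : ℝ≥0∞ :=
  ∫⁻ ω, (wordLength S (position ω n) : ℝ≥0∞) ∂(incrementLaw μ)

/-- The walk is diffusive: `L(n) ≤ C √n` for some `C > 0` and all `n`. -/
def IsDiffusive {G : Type*} [Group G] [MeasurableSpace G] (S : Finset G) (μ : PMF G) : Prop :=
  ∃ C : ℝ, 0 < C ∧ ∀ n : ℕ, drift S μ n ≤ ENNReal.ofReal (C * √n)

/-- The walk is totally cautious: for every `ε > 0` there is `p > 0` such that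
`P(max_{1 ≤ k ≤ n} l_S(W_k) ≤ ε √n) ≥ p` for every `n ≥ 1` for which the ball of radius `ε √n`
contains a possible first step of the walk. For the other `n` the probability is zero; there are
only finitely many of them, and none if `μ` charges the identity. -/
def IsTotallyCautious {G : Type*} [Group G] [MeasurableSpace G] (S : Finset G) (μ : PMF G) :
    Prop :=
  ∀ ε : ℝ, 0 < ε → ∃ p : ℝ, 0 < p ∧ ∀ n : ℕ, 1 ≤ n →
    (∃ g ∈ μ.support, (wordLength S g : ℝ) ≤ ε * √n) →
    p ≤ (incrementLaw μ).real
      {ω | ∀ k, 1 ≤ k → k ≤ n → (wordLength S (position ω k) : ℝ) ≤ ε * √n}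

/-- The `l_p`-profile `λ_{S,p}(B(e, r))` inside the ball of radius `r`, for the step
distribution `μ`: the infimum of `½ ∑_{x,y} |f(x) - f(xy)|^p μ(y)` over the functions `f` that are
supported in `B(e, r)` and have `‖f‖_p = 1`. -/
def lpProfile {G : Type*} [Group G] (S : Finset G) (μ : PMF G) (p r : ℝ) : ℝ :=
  sInf {E | ∃ f : G → ℝ, Function.support f ⊆ ball S r ∧
    (∑' x, |f x| ^ p) ^ (1 / p) = 1 ∧
    E = 1 / 2 * ∑' z : G × G, |f z.1 - f (z.1 * z.2)| ^ p * (μ z.2).toReal}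

end ANGroup

end

open scoped Pointwise

namespace ANGroup

variable {G : Type*} [Group G]

/-! ### Word length -/

/-! Everything follows from functions supported in `B(e, r)` with Rayleigh quotient of order `r ^
(-p)`. To find them, put a 1-Lipschitz tent of height `m` over every piece of an Assouad-Nagata
partition at scale `2m`. Every point is at the top of some tent, each support has diameter `O(m)`,
and at most `d + 1` supports meet at a point. Amenability gives a finite `F` whose
`O(m)`-neighbourhood has fewer than `2|F|` points. Averaging over the tents that meet `F` yields one
with `m ^ p * |supp| ≤ 2(d+1) ‖f‖_p ^ p` (`exists_bump`); translated to `e` and normalised, it is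
the required function (`exists_energy_le`).

For `p = 2` let `P` be the symmetric transition matrix of the walk killed outside `B = B(e, r)`. For
a unit vector `f`, `⟨f, P f⟩ = 1 - energy`, and log-convexity of the moments gives `(1 - C/r²)^(2n)
≤ ⟨f, P^(2n) f⟩`. The right side is at most the largest row sum of `P^(2n)`, a survival probability,
and at most its trace, which is at most `|B| p_{2n}(e,e)` (`pow_le_survival`).

Taking `r = ε√n` gives total caution. Taking `r = n^(1/3)` balances the decay `n/r²` against the
growth `log |B| = O(r)` and gives the return probability. Bernoulli's inequality turns survival into
the tail bound `P(l_S(W_n) > r) ≤ Cn/r²`, whose dyadic sum gives diffusivity. -/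

theorem wordLength_prod_le {S : Finset G} {w : List G} (hw : ∀ s ∈ w, s ∈ S) :
    wordLength S w.prod ≤ w.length :=
  Nat.sInf_le ⟨w, hw, rfl, rfl⟩

theorem IsSymmGenerating.exists_word {S : Finset G} (hS : IsSymmGenerating S) (g : G) :
    ∃ w : List G, (∀ s ∈ w, s ∈ S) ∧ w.length = wordLength S g ∧ w.prod = g := by
  have hg : g ∈ Submonoid.closure ((S : Set G) ∪ (S : Set G)⁻¹) := by
    rw [← Subgroup.closure_toSubmonoid, hS.closure_eq_top]; trivial
  obtain ⟨w, hw, hwg⟩ := Submonoid.exists_list_of_mem_closure hg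
  have hne : {n | ∃ w : List G, (∀ s ∈ w, s ∈ S) ∧ w.length = n ∧ w.prod = g}.Nonempty := by
    refine ⟨w.length, w, fun s hs => ?_, rfl, hwg⟩
    rcases hw s hs with h | h
    · exact h
    · simpa using hS.inv_mem _ h
  exact Nat.sInf_mem hne

@[simp] theorem wordLength_one (S : Finset G) : wordLength S (1 : G) = 0 :=
  Nat.le_zero.1 (wordLength_prod_le (S := S) (w := []) (by simp))

theorem IsSymmGenerating.wordLength_mul_le {S : Finset G} (hS : IsSymmGenerating S) (g h : G) :
    wordLength S (g * h) ≤ wordLength S g + wordLength S h := by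
  obtain ⟨w, hw, hwl, hwg⟩ := hS.exists_word g
  obtain ⟨v, hv, hvl, hvg⟩ := hS.exists_word h
  rw [← hwl, ← hvl, ← List.length_append]
  conv_lhs => rw [← hwg, ← hvg, ← List.prod_append]
  exact wordLength_prod_le fun s hs => (List.mem_append.1 hs).elim (hw s) (hv s)

theorem IsSymmGenerating.wordLength_inv_le {S : Finset G} (hS : IsSymmGenerating S) (g : G) :
    wordLength S g⁻¹ ≤ wordLength S g := by
  obtain ⟨w, hw, hwl, hwg⟩ := hS.exists_word g
  conv_lhs => rw [← hwg, List.prod_inv_reverse]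
  rw [← hwl]
  refine (wordLength_prod_le fun s hs => ?_).trans (by simp)
  obtain ⟨t, ht, rfl⟩ := List.mem_map.1 (List.mem_reverse.1 hs)
  exact hS.inv_mem _ (hw t ht)

theorem IsSymmGenerating.wordLength_inv {S : Finset G} (hS : IsSymmGenerating S) (g : G) :
    wordLength S g⁻¹ = wordLength S g :=
  (hS.wordLength_inv_le g).antisymm (by simpa using hS.wordLength_inv_le g⁻¹)

theorem IsSymmGenerating.exists_wordLength_le_mul {S T : Finset G} (hS : IsSymmGenerating S)
    (hT : IsSymmGenerating T) : ∃ M : ℕ, 1 ≤ M ∧ ∀ g, wordLength S g ≤ M * wordLength T g := by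
  refine ⟨T.sup (wordLength S) + 1, by omega, fun g => ?_⟩
  obtain ⟨w, hw, hwl, rfl⟩ := hT.exists_word g
  rw [← hwl]
  clear hwl
  induction w with
  | nil => simp
  | cons t w ih =>
    have h1 := hS.wordLength_mul_le t w.prod
    have h2 := ih fun s hs => hw s (List.mem_cons_of_mem _ hs)
    have h3 : wordLength S t ≤ T.sup (wordLength S) := Finset.le_sup (hw t List.mem_cons_self)
    rw [List.prod_cons, List.length_cons, mul_add]
    omega

theorem IsSymmGenerating.mem_pow_of_wordLength_le [DecidableEq G] {S : Finset G}
    (hS : IsSymmGenerating S) {n : ℕ} {g : G} (hg : wordLength S g ≤ n) : g ∈ (insert 1 S) ^ n := by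
  obtain ⟨w, hw, hwl, rfl⟩ := hS.exists_word g
  refine Finset.pow_subset_pow_right (Finset.mem_insert_self _ _) (hwl ▸ hg) ?_
  clear hg hwl
  induction w with
  | nil => simp
  | cons t w ih =>
    rw [List.prod_cons, List.length_cons, pow_succ']
    exact Finset.mul_mem_mul (Finset.mem_insert_of_mem (hw t List.mem_cons_self))
      (ih fun s hs => hw s (List.mem_cons_of_mem _ hs))

theorem IsSymmGenerating.finite_ball {S : Finset G} (hS : IsSymmGenerating S) (r : ℝ) :
    (ball S r).Finite := by
  classical
  exact (Finset.finite_toSet ((insert 1 S) ^ ⌊r⌋₊)).subset fun g hg =>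
    hS.mem_pow_of_wordLength_le (Nat.le_floor hg)

theorem IsSymmGenerating.ncard_ball_le {S : Finset G} (hS : IsSymmGenerating S) (r : ℝ) :
    (ball S r).ncard ≤ (S.card + 1) ^ ⌊r⌋₊ := by
  classical
  calc (ball S r).ncard ≤ (((insert 1 S) ^ ⌊r⌋₊ : Finset G) : Set G).ncard :=
        Set.ncard_le_ncard (fun g hg => hS.mem_pow_of_wordLength_le (Nat.le_floor hg))
          (Finset.finite_toSet _)
    _ ≤ (insert 1 S).card ^ ⌊r⌋₊ := by rw [Set.ncard_coe_finset]; exact Finset.card_pow_le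
    _ ≤ _ := Nat.pow_le_pow_left (Finset.card_insert_le _ _) _

theorem IsSymmGenerating.countable {S : Finset G} (hS : IsSymmGenerating S) : Countable G := by
  rw [← Set.countable_univ_iff]
  refine (Set.countable_iUnion fun n : ℕ => (hS.finite_ball n).countable).mono fun g _ => ?_
  exact Set.mem_iUnion.2 ⟨wordLength S g, le_refl (wordLength S g : ℝ)⟩

/-! ### Sets of small doubling in amenable groups -/

theorem finAdd_biUnion {α ι : Type*} {m : Set α → ℝ}
    (hadd : ∀ A B, Disjoint A B → m (A ∪ B) = m A + m B) (s : Finset ι) (A : ι → Set α)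
    (hA : (s : Set ι).PairwiseDisjoint A) : m (⋃ i ∈ s, A i) = ∑ i ∈ s, m (A i) := by
  classical
  induction s using Finset.induction_on with
  | empty =>
    have := hadd ∅ ∅ (by simp)
    simp only [Set.union_empty] at this
    simp; linarith
  | insert i s hi ih =>
    rw [Finset.set_biUnion_insert, hadd, Finset.sum_insert hi, ih]
    · exact hA.subset (by simp)
    · refine Set.disjoint_iUnion₂_right.2 fun j hj => hA (by simp) (by simp [hj]) ?_
      rintro rfl; exact hi hj

/-- Otherwise Hall's marriage theorem gives an injection `φ` of `G × Bool` into `G` with `φ (x, i) ∈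
B x`, which is a paradoxical decomposition. For each `i` the sets `A (i, b)` partition `G`, while
the translates `b A (i, b)` over all `(i, b)` are disjoint, so an invariant mean would give mass 2
inside mass 1. -/
theorem IsAmenable.exists_card_mul_left_lt [DecidableEq G] (hG : IsAmenable G) (B : Finset G) :
    ∃ F : Finset G, (B * F).card < 2 * F.card := by
  by_contra! h
  obtain ⟨m, hm0, hm1, hadd, hinv⟩ := hG
  let t : G × Bool → Finset G := fun z => B * {z.1}
  have hall : ∀ s : Finset (G × Bool), s.card ≤ (s.biUnion t).card := by
    intro s
    calc s.card ≤ (s.image Prod.fst ×ˢ (Finset.univ : Finset Bool)).card :=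
          Finset.card_le_card fun z hz => Finset.mem_product.2
            ⟨Finset.mem_image_of_mem _ hz, Finset.mem_univ _⟩
      _ = 2 * (s.image Prod.fst).card := by rw [Finset.card_product]; simp [mul_comm]
      _ ≤ (B * s.image Prod.fst).card := h _
      _ ≤ _ := Finset.card_le_card fun y hy => by
          obtain ⟨b, hb, x, hx, rfl⟩ := Finset.mem_mul.1 hy
          obtain ⟨z, hz, rfl⟩ := Finset.mem_image.1 hx
          exact Finset.mem_biUnion.2 ⟨z, hz, Finset.mul_mem_mul hb (by simp)⟩
  obtain ⟨φ, hφ, hφt⟩ := (Finset.all_card_le_biUnion_card_iff_exists_injective t).1 hall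
  let A : Bool × G → Set G := fun j => {x | φ (x, j.1) = j.2 * x}
  have hunion : ∀ i, ⋃ b ∈ B, A (i, b) = Set.univ := fun i => Set.eq_univ_of_forall fun x => by
    obtain ⟨b, hb, y, hy, hby⟩ := Finset.mem_mul.1 (hφt (x, i))
    rw [Finset.mem_singleton.1 hy] at hby
    exact Set.mem_iUnion₂.2 ⟨b, hb, hby.symm⟩
  have hsum : ∀ i, ∑ b ∈ B, m (A (i, b)) = 1 := fun i => by
    rw [← finAdd_biUnion hadd B (fun b => A (i, b)), hunion, hm1]
    intro b _ c _ hbc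
    refine Set.disjoint_left.2 fun x hx hy => hbc ?_
    exact mul_right_cancel (Eq.trans (Eq.symm hx) hy)
  have hC : ((Finset.univ ×ˢ B : Finset (Bool × G)) : Set (Bool × G)).PairwiseDisjoint
      (fun j => (fun x => j.2 * x) '' A j) := by
    rintro ⟨i, b⟩ _ ⟨j, c⟩ _ hne
    refine Set.disjoint_left.2 ?_
    rintro _ ⟨x, hx, rfl⟩ ⟨y, hy, hxy⟩
    have hx' : φ (x, i) = b * x := hx
    have hy' : φ (y, j) = c * y := hy
    have h1 := hφ (hx'.trans (hxy.symm.trans hy'.symm))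
    simp only [Prod.mk.injEq] at h1 hne
    obtain ⟨rfl, rfl⟩ := h1
    exact hne (Prod.ext rfl (mul_right_cancel hxy).symm)
  have h2 := finAdd_biUnion hadd _ _ hC
  simp only [hinv] at h2
  rw [Finset.sum_product] at h2
  simp only [hsum] at h2
  set U : Set G := ⋃ j ∈ (Finset.univ ×ˢ B : Finset (Bool × G)), (fun x => j.2 * x) '' A j
  have h3 := hadd U Uᶜ disjoint_compl_right
  rw [Set.union_compl_self, hm1, h2] at h3
  have h4 := hm0 Uᶜ
  simp at h3
  linarith

theorem IsAmenable.exists_card_mul_lt [DecidableEq G] (hG : IsAmenable G) (B : Finset G) :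
    ∃ F : Finset G, (F * B).card < 2 * F.card := by
  obtain ⟨F, hF⟩ := hG.exists_card_mul_left_lt B⁻¹
  refine ⟨F⁻¹, ?_⟩
  rwa [Finset.card_inv, ← Finset.card_inv, mul_inv_rev, inv_inv]

/-! ### Bump functions -/

/-- The word distance from a point to a set. -/
noncomputable def distTo (T : Finset G) (A : Set G) (x : G) : ℕ :=
  sInf {n | ∃ a ∈ A, wordLength T (x⁻¹ * a) = n}

/-- The tent function of height `m` over the set `A`. -/
noncomputable def bump (T : Finset G) (m : ℕ) (A : Set G) (x : G) : ℕ := m - distTo T A x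

theorem exists_distTo_eq (T : Finset G) {A : Set G} (hA : A.Nonempty) (x : G) :
    ∃ a ∈ A, wordLength T (x⁻¹ * a) = distTo T A x := by
  obtain ⟨a, ha⟩ := hA
  exact Nat.sInf_mem (s := {n | ∃ a ∈ A, wordLength T (x⁻¹ * a) = n}) ⟨_, a, ha, rfl⟩

theorem distTo_le (T : Finset G) {A : Set G} {a : G} (ha : a ∈ A) (x : G) :
    distTo T A x ≤ wordLength T (x⁻¹ * a) :=
  Nat.sInf_le ⟨a, ha, rfl⟩

theorem bump_of_mem (T : Finset G) (m : ℕ) {A : Set G} {x : G} (hx : x ∈ A) :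
    bump T m A x = m := by
  have := distTo_le T hx x
  simp at this
  simp [bump, this]

theorem exists_lt_of_bump_ne_zero {T : Finset G} {m : ℕ} {A : Set G} (hA : A.Nonempty) {x : G}
    (hx : bump T m A x ≠ 0) : ∃ a ∈ A, wordLength T (x⁻¹ * a) < m := by
  obtain ⟨a, ha, h⟩ := exists_distTo_eq T hA x
  refine ⟨a, ha, ?_⟩
  rw [bump] at hx
  omega

theorem IsSymmGenerating.bump_le {T : Finset G} (hT : IsSymmGenerating T) (m : ℕ) {A : Set G}
    (hA : A.Nonempty) (x g : G) : bump T m A x ≤ bump T m A (x * g) + wordLength T g := by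
  obtain ⟨a, ha, h⟩ := exists_distTo_eq T hA x
  have h1 := distTo_le T ha (x * g)
  have h2 := hT.wordLength_mul_le g⁻¹ (x⁻¹ * a)
  have h3 : g⁻¹ * (x⁻¹ * a) = (x * g)⁻¹ * a := by group
  rw [h3, hT.wordLength_inv] at h2
  simp only [bump]
  omega

theorem IsSymmGenerating.abs_bump_sub_le {T : Finset G} (hT : IsSymmGenerating T) (m : ℕ)
    {A : Set G} (hA : A.Nonempty) (x g : G) :
    |(bump T m A x : ℝ) - bump T m A (x * g)| ≤ wordLength T g := by
  have h1 := hT.bump_le m hA x g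
  have h2 := hT.bump_le m hA (x * g) g⁻¹
  rw [mul_inv_cancel_right, hT.wordLength_inv] at h2
  rw [abs_le]
  constructor
  · have : (bump T m A (x * g) : ℝ) ≤ bump T m A x + wordLength T g := by exact_mod_cast h2
    linarith
  · have : (bump T m A x : ℝ) ≤ bump T m A (x * g) + wordLength T g := by exact_mod_cast h1
    linarith

/-- Bump functions over the pieces of a partition given by the Assouad-Nagata dimension. -/
theorem exists_bump_family {T : Finset G} (hT : IsSymmGenerating T) {d : ℕ}
    (hd : ANDimLE (wordDist T) d) :
    ∃ κ : ℕ, ∀ m : ℕ, 1 ≤ m → ∃ f : Set G → G → ℕ, ∃ P : Set (Set G),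
      (∀ x, ∃ A ∈ P, f A x = m) ∧
      (∀ A ∈ P, ∀ x y, f A x ≠ 0 → f A y ≠ 0 → wordLength T (x⁻¹ * y) ≤ κ * m) ∧
      (∀ A ∈ P, ∀ x g, |(f A x : ℝ) - f A (x * g)| ≤ wordLength T g) ∧
      ∀ x, {A ∈ P | f A x ≠ 0}.Finite ∧ {A ∈ P | f A x ≠ 0}.ncard ≤ d + 1 := by
  obtain ⟨K, hK1, hK⟩ := hd
  -- Pieces have diameter at most `K * 2m`, and a tent adds less than `m` at either end.
  refine ⟨2 * ⌈K⌉₊ + 2, fun m hm => ?_⟩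
  have hm' : (1 : ℝ) ≤ m := by exact_mod_cast hm
  -- Tents of height `m` reach less than `m` beyond their pieces, so separation `2m` keeps tents of
  -- one colour disjoint.
  obtain ⟨P, col, hP, hdiam, hsep⟩ := hK (2 * m) (by linarith)
  have hne : ∀ A ∈ P, A.Nonempty := fun A hA =>
    Set.nonempty_iff_ne_empty.2 fun h => hP.1 (h ▸ hA)
  refine ⟨bump T m, P, fun x => ?_, fun A hA x y hx hy => ?_,
    fun A hA x g => hT.abs_bump_sub_le m (hne A hA) x g, fun x => ?_⟩
  · obtain ⟨A, ⟨hA, hx⟩, -⟩ := hP.2 x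
    exact ⟨A, hA, bump_of_mem T m hx⟩
  · obtain ⟨a, ha, hxa⟩ := exists_lt_of_bump_ne_zero (hne A hA) hx
    obtain ⟨b, hb, hyb⟩ := exists_lt_of_bump_ne_zero (hne A hA) hy
    have h1 := hdiam A hA a ha b hb
    have h2 : wordLength T (a⁻¹ * b) ≤ 2 * ⌈K⌉₊ * m := by
      have : (wordLength T (a⁻¹ * b) : ℝ) ≤ 2 * ⌈K⌉₊ * m := by
        refine h1.trans ?_
        have := Nat.le_ceil K
        nlinarith
      exact_mod_cast this
    have h3 := hT.wordLength_mul_le (x⁻¹ * a) (a⁻¹ * b * (b⁻¹ * y))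
    have h4 := hT.wordLength_mul_le (a⁻¹ * b) (b⁻¹ * y)
    have h5 := hT.wordLength_inv (y⁻¹ * b)
    have h6 : (y⁻¹ * b)⁻¹ = b⁻¹ * y := by group
    have h7 : x⁻¹ * a * (a⁻¹ * b * (b⁻¹ * y)) = x⁻¹ * y := by group
    rw [h6] at h5
    rw [h7] at h3
    rw [add_mul]
    omega
  · have hinj : Set.InjOn col {A ∈ P | bump T m A x ≠ 0} := by
      rintro A ⟨hA, hAx⟩ B ⟨hB, hBx⟩ hAB
      by_contra hne'
      obtain ⟨r', hr', hr⟩ := hsep A hA B hB hne' hAB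
      obtain ⟨a, ha, hxa⟩ := exists_lt_of_bump_ne_zero (hne A hA) hAx
      obtain ⟨b, hb, hxb⟩ := exists_lt_of_bump_ne_zero (hne B hB) hBx
      have h1 := hr a ha b hb
      have h2 := hT.wordLength_mul_le (a⁻¹ * x) (x⁻¹ * b)
      have h3 := hT.wordLength_inv (x⁻¹ * a)
      have h4 : (x⁻¹ * a)⁻¹ = a⁻¹ * x := by group
      have h5 : a⁻¹ * x * (x⁻¹ * b) = a⁻¹ * b := by group
      rw [h4] at h3
      rw [h5] at h2
      have h6 : (wordLength T (a⁻¹ * b) : ℝ) ≤ 2 * m := by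
        have : wordLength T (a⁻¹ * b) ≤ 2 * m := by omega
        exact_mod_cast this
      simp only [wordDist] at h1
      linarith
    refine ⟨Set.Finite.of_finite_image (Set.toFinite _) hinj, ?_⟩
    rw [← hinj.ncard_image]
    refine (Set.ncard_le_ncard (Set.subset_univ _)).trans ?_
    simp [Set.ncard_univ]

end ANGroup

namespace ANGroup

variable {G : Type*} [Group G]

/-! ### Energies -/

/-- The `p`-energy of a function with respect to the step distribution `μ`. -/
noncomputable def energy (μ : PMF G) (p : ℝ) (f : G → ℝ) : ℝ :=
  1 / 2 * ∑' z : G × G, |f z.1 - f (z.1 * z.2)| ^ p * (μ z.2).toReal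

theorem energy_nonneg (μ : PMF G) (p : ℝ) (f : G → ℝ) : 0 ≤ energy μ p f := by
  unfold energy
  have : 0 ≤ ∑' z : G × G, |f z.1 - f (z.1 * z.2)| ^ p * (μ z.2).toReal :=
    tsum_nonneg fun z => by positivity
  positivity

theorem sum_toReal_le_one {α : Type*} (μ : PMF α) (Y : Finset α) : ∑ y ∈ Y, (μ y).toReal ≤ 1 := by
  rw [← ENNReal.toReal_sum fun y _ => μ.apply_ne_top y]
  refine ENNReal.toReal_le_of_le_ofReal zero_le_one ?_
  rw [ENNReal.ofReal_one, ← μ.tsum_coe]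
  exact ENNReal.sum_le_tsum Y

theorem sum_toReal_eq_one {α : Type*} (μ : PMF α) {Y : Finset α} (hY : μ.support ⊆ Y) :
    ∑ y ∈ Y, (μ y).toReal = 1 := by
  have h : ∑ y ∈ Y, μ y = 1 := by
    rw [← μ.tsum_coe]
    refine (tsum_eq_sum fun y hy => ?_).symm
    by_contra h
    exact hy (hY ((μ.mem_support_iff y).2 h))
  rw [← ENNReal.toReal_sum fun y _ => μ.apply_ne_top y, h, ENNReal.toReal_one]

theorem energy_eq_sum [DecidableEq G] {μ : PMF G} {p : ℝ} (hp : p ≠ 0) {f : G → ℝ}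
    {X Y : Finset G} (hX : Function.support f ⊆ X) (hY : μ.support ⊆ Y) :
    energy μ p f = 1 / 2 * ∑ y ∈ Y, ∑ x ∈ X ∪ X * Y⁻¹,
      |f x - f (x * y)| ^ p * (μ y).toReal := by
  rw [energy, ← Finset.sum_product_right' (X ∪ X * Y⁻¹) Y
    (fun x y => |f x - f (x * y)| ^ p * (μ y).toReal), tsum_eq_sum]
  rintro ⟨x, y⟩ hz
  by_cases hy : y ∈ Y
  · have hx : x ∉ X ∪ X * Y⁻¹ := fun h => hz (Finset.mem_product.2 ⟨h, hy⟩)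
    rw [Finset.mem_union, not_or] at hx
    have h1 : f x = 0 := by
      by_contra h
      exact hx.1 (hX h)
    have h2 : f (x * y) = 0 := by
      by_contra h
      refine hx.2 (Finset.mem_mul.2 ⟨x * y, hX h, y⁻¹, Finset.inv_mem_inv hy, by simp⟩)
    simp [h1, h2, Real.zero_rpow hp]
  · have : μ y = 0 := by
      by_contra h
      exact hy (hY ((μ.mem_support_iff y).2 h))
    simp [this]

/-- For fixed `y` a term is nonzero only if `x` or `x * y` lies in `X`, which allows at most `2 |X|`
points `x`; the factor `1/2` absorbs the 2. -/
theorem energy_le {μ : PMF G} (hμ : μ.support.Finite) {p : ℝ} (hp : 0 < p) {f : G → ℝ}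
    {X : Finset G} (hX : Function.support f ⊆ X) {c : ℝ}
    (hc : ∀ x, ∀ y ∈ μ.support, |f x - f (x * y)| ≤ c) : energy μ p f ≤ c ^ p * X.card := by
  classical
  have hc0 : 0 ≤ c := by
    obtain ⟨y, hy⟩ := μ.support_nonempty
    exact (abs_nonneg _).trans (hc 1 y hy)
  have hY : μ.support ⊆ hμ.toFinset := by simp
  rw [energy_eq_sum hp.ne' hX hY]
  have key : ∀ y ∈ hμ.toFinset, ∑ x ∈ X ∪ X * hμ.toFinset⁻¹, |f x - f (x * y)| ^ p *
      (μ y).toReal ≤ 2 * (c ^ p * X.card) * (μ y).toReal := by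
    intro y hy
    rw [← Finset.sum_mul]
    refine mul_le_mul_of_nonneg_right ?_ ENNReal.toReal_nonneg
    calc ∑ x ∈ X ∪ X * hμ.toFinset⁻¹, |f x - f (x * y)| ^ p
        ≤ ∑ x ∈ X ∪ X * hμ.toFinset⁻¹, if x ∈ X ∪ X * {y⁻¹} then c ^ p else 0 := by
          refine Finset.sum_le_sum fun x _ => ?_
          split_ifs with h
          · exact Real.rpow_le_rpow (abs_nonneg _) (hc x y (by simpa using hy)) hp.le
          · rw [Finset.mem_union, not_or] at h
            have h1 : f x = 0 := by
              by_contra h'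
              exact h.1 (hX h')
            have h2 : f (x * y) = 0 := by
              by_contra h'
              exact h.2 (Finset.mem_mul.2 ⟨x * y, hX h', y⁻¹, by simp, by simp⟩)
            simp [h1, h2, Real.zero_rpow hp.ne']
      _ ≤ (X ∪ X * {y⁻¹}).card • c ^ p := by
          rw [← Finset.sum_filter, Finset.sum_const]
          refine nsmul_le_nsmul_left (by positivity) (Finset.card_le_card fun x hx => ?_)
          exact (Finset.mem_filter.1 hx).2
      _ ≤ (X.card + X.card) • c ^ p := by
          refine nsmul_le_nsmul_left (by positivity) ((Finset.card_union_le _ _).trans ?_)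
          refine Nat.add_le_add_left (Finset.card_mul_le.trans ?_) _
          simp
      _ = 2 * (c ^ p * X.card) := by rw [nsmul_eq_mul]; push_cast; ring
  calc 1 / 2 * ∑ y ∈ hμ.toFinset, ∑ x ∈ X ∪ X * hμ.toFinset⁻¹, |f x - f (x * y)| ^ p *
      (μ y).toReal ≤ 1 / 2 * ∑ y ∈ hμ.toFinset, 2 * (c ^ p * X.card) * (μ y).toReal := by
        gcongr with y hy
        exact key y hy
    _ = c ^ p * X.card * ∑ y ∈ hμ.toFinset, (μ y).toReal := by rw [← Finset.mul_sum]; ring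
    _ ≤ c ^ p * X.card := mul_le_of_le_one_right (by positivity) (sum_toReal_le_one μ _)

/-! ### Functions of small energy supported in balls -/

/-- Double counting over the tents that meet `F`: their supports lie in `F * B` and overlap at most
`d + 1` times, so the sizes sum to at most `2(d+1)|F|`, while the `p`-th powers sum to at least `|F|
m ^ p`. Some tent is at least as good as the average. -/
theorem exists_bump (hG : IsAmenable G) {T : Finset G} (hT : IsSymmGenerating T) {d : ℕ}
    (hd : ANDimLE (wordDist T) d) {p : ℝ} (hp : 0 < p) :
    ∃ κ : ℕ, ∀ m : ℕ, 1 ≤ m → ∃ (f : G → ℝ) (X : Finset G), X.Nonempty ∧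
      Function.support f = X ∧ (∀ x ∈ X, wordLength T x ≤ κ * m) ∧
      (∀ x g, |f x - f (x * g)| ≤ wordLength T g) ∧
      (m : ℝ) ^ p * X.card ≤ 2 * (d + 1) * ∑ x ∈ X, |f x| ^ p := by
  classical
  obtain ⟨κ, hκ⟩ := exists_bump_family hT hd
  refine ⟨κ, fun m hm => ?_⟩
  obtain ⟨f, P, hfm, hfX, hLip, hcard⟩ := hκ m hm
  have hm0 : (0 : ℝ) < m := by exact_mod_cast hm
  let B : Finset G := (hT.finite_ball (κ * m : ℕ)).toFinset
  have hB : ∀ g, g ∈ B ↔ wordLength T g ≤ κ * m := fun g => by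
    simp only [B, Set.Finite.mem_toFinset, ball, Set.mem_ofPred_eq, Nat.cast_le]
  obtain ⟨F, hF⟩ := hG.exists_card_mul_lt B
  have hIfin : {A ∈ P | ∃ x ∈ F, f A x ≠ 0}.Finite := by
    refine (F.finite_toSet.biUnion fun x _ => (hcard x).1).subset ?_
    rintro A ⟨hA, x, hx, hAx⟩
    exact Set.mem_biUnion hx ⟨hA, hAx⟩
  let I : Finset (Set G) := hIfin.toFinset
  have hI : ∀ A, A ∈ I ↔ A ∈ P ∧ ∃ x ∈ F, f A x ≠ 0 := fun A => by simp [I]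
  have hsupp : ∀ A ∈ I, ∀ x, f A x ≠ 0 → x ∈ F * B := fun A hA x hx => by
    obtain ⟨hAP, z, hz, hAz⟩ := (hI A).1 hA
    exact Finset.mem_mul.2 ⟨z, hz, z⁻¹ * x, (hB _).2 (hfX A hAP z x hAz hx), by simp⟩
  have hFB : F ⊆ F * B := fun x hx =>
    Finset.mem_mul.2 ⟨x, hx, 1, (hB 1).2 (by simp), mul_one x⟩
  let X : Set G → Finset G := fun A => (F * B).filter fun x => f A x ≠ 0
  have hupper : ∑ A ∈ I, ((X A).card : ℝ) ≤ 2 * (d + 1) * F.card := by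
    have h1 : ∑ A ∈ I, (X A).card ≤ (F * B).card * (d + 1) := by
      calc ∑ A ∈ I, (X A).card = ∑ x ∈ F * B, (I.filter fun A => f A x ≠ 0).card :=
            Finset.sum_card_bipartiteAbove_eq_sum_card_bipartiteBelow _
        _ ≤ ∑ x ∈ F * B, (d + 1) := Finset.sum_le_sum fun x _ => by
            rw [← Set.ncard_coe_finset]
            refine (Set.ncard_le_ncard ?_ (hcard x).1).trans (hcard x).2
            intro A hA
            have hA' := Finset.mem_filter.1 (Finset.mem_coe.1 hA)
            exact ⟨((hI A).1 hA'.1).1, hA'.2⟩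
        _ = _ := by simp
    have h2 : ∑ A ∈ I, (X A).card ≤ 2 * F.card * (d + 1) :=
      h1.trans (Nat.mul_le_mul_right _ hF.le)
    have h3 : ((∑ A ∈ I, (X A).card : ℕ) : ℝ) ≤ (2 * F.card * (d + 1) : ℕ) := by
      exact_mod_cast h2
    push_cast at h3
    linarith
  have hsumX : ∀ A, ∑ x ∈ F * B, (f A x : ℝ) ^ p = ∑ x ∈ X A, (f A x : ℝ) ^ p := fun A => by
    refine (Finset.sum_filter_of_ne (p := fun x => f A x ≠ 0) fun x _ hx h0 => hx ?_).symm
    rw [h0]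
    simp [Real.zero_rpow hp.ne']
  have hlower : F.card * (m : ℝ) ^ p ≤ ∑ A ∈ I, ∑ x ∈ X A, (f A x : ℝ) ^ p := by
    calc F.card * (m : ℝ) ^ p = ∑ x ∈ F, (m : ℝ) ^ p := by simp
      _ ≤ ∑ x ∈ F, ∑ A ∈ I, (f A x : ℝ) ^ p := Finset.sum_le_sum fun x hx => by
          obtain ⟨A, hA, hAx⟩ := hfm x
          have hAI : A ∈ I := (hI A).2 ⟨hA, x, hx, by omega⟩
          rw [← hAx]
          exact Finset.single_le_sum (f := fun A => (f A x : ℝ) ^ p)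
            (fun A _ => by positivity) hAI
      _ ≤ ∑ x ∈ F * B, ∑ A ∈ I, (f A x : ℝ) ^ p :=
          Finset.sum_le_sum_of_subset_of_nonneg hFB fun x _ _ =>
            Finset.sum_nonneg fun A _ => by positivity
      _ = ∑ A ∈ I, ∑ x ∈ F * B, (f A x : ℝ) ^ p := Finset.sum_comm
      _ = _ := Finset.sum_congr rfl fun A _ => hsumX A
  have hIne : I.Nonempty := by
    have : F.Nonempty := by
      rw [Finset.nonempty_iff_ne_empty]
      rintro rfl
      simp at hF
    obtain ⟨x, hx⟩ := this
    obtain ⟨A, hA, hAx⟩ := hfm x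
    exact ⟨A, (hI A).2 ⟨hA, x, hx, by omega⟩⟩
  obtain ⟨A, hA, hle⟩ : ∃ A ∈ I, (m : ℝ) ^ p * (X A).card ≤
      2 * (d + 1) * ∑ x ∈ X A, (f A x : ℝ) ^ p := by
    refine Finset.exists_le_of_sum_le hIne ?_
    rw [← Finset.mul_sum, ← Finset.mul_sum]
    calc (m : ℝ) ^ p * ∑ A ∈ I, ((X A).card : ℝ) ≤ (m : ℝ) ^ p * (2 * (d + 1) * F.card) := by
          gcongr
      _ = 2 * (d + 1) * (F.card * (m : ℝ) ^ p) := by ring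
      _ ≤ _ := by gcongr
  -- Left translation moves a support point `a` to `e`; the diameter bound then becomes a ball about
  -- `e`.
  obtain ⟨hAP, a, ha, haA⟩ := (hI A).1 hA
  have hXa : a ∈ X A := Finset.mem_filter.2 ⟨hFB ha, haA⟩
  have hXiff : ∀ x, x ∈ X A ↔ f A x ≠ 0 := fun x =>
    ⟨fun h => (Finset.mem_filter.1 h).2, fun h => Finset.mem_filter.2 ⟨hsupp A hA x h, h⟩⟩
  have himg : ∀ x, x ∈ (X A).image (a⁻¹ * ·) ↔ f A (a * x) ≠ 0 := fun x => by
    rw [← hXiff, Finset.mem_image]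
    exact ⟨fun ⟨y, hy, h⟩ => by rw [← h]; simpa using hy, fun h => ⟨a * x, h, by simp⟩⟩
  refine ⟨fun x => f A (a * x), (X A).image (a⁻¹ * ·), ⟨_, Finset.mem_image_of_mem _ hXa⟩,
    ?_, fun x hx => ?_, fun x g => ?_, ?_⟩
  · ext x
    rw [Finset.mem_coe, himg]
    simp
  · obtain ⟨y, hy, rfl⟩ := Finset.mem_image.1 hx
    exact hfX A hAP a y haA ((hXiff y).1 hy)
  · simp only [← mul_assoc]
    exact hLip A hAP (a * x) g
  · rw [Finset.card_image_of_injective _ (mul_right_injective a⁻¹),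
      Finset.sum_image (mul_right_injective a⁻¹).injOn]
    simpa using hle

/-- The `l_p`-profile of a ball is at most of order `r ^ (-p)`, witnessed by functions. -/
theorem exists_energy_le (hG : IsAmenable G) (hdim : HasFiniteANDim G) {S : Finset G}
    (hS : IsSymmGenerating S) {μ : PMF G} (hμ : μ.support.Finite) {p : ℝ} (hp : 0 < p) :
    ∃ C : ℝ, 0 < C ∧ ∀ r : ℝ, 0 < r → ∃ f : G → ℝ, Function.support f ⊆ ball S r ∧
      ∑' x, |f x| ^ p = 1 ∧ energy μ p f ≤ C * r ^ (-p) := by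
  obtain ⟨T, hT, d, hd⟩ := hdim
  obtain ⟨κ, hκ⟩ := exists_bump hG hT hd hp
  obtain ⟨M, hM1, hM⟩ := hS.exists_wordLength_le_mul hT
  let L : ℕ := hμ.toFinset.sup (wordLength T)
  have hL : ∀ y ∈ μ.support, wordLength T y ≤ L := fun y hy =>
    Finset.le_sup (f := wordLength T) (by simpa using hy)
  -- The height `m = ⌊r / R⌋` keeps the support in the `S`-ball of radius `r`; the `+ 1` ensures `R
  -- > 0`.
  let R : ℝ := M * κ + 1
  have hR : 0 < R := by positivity
  let E : ℝ := energy μ p (Set.indicator {1} fun _ => 1)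
  have hE : 0 ≤ E := energy_nonneg _ _ _
  -- The first summand serves `r ≥ R`, the second serves `r < R`, where the indicator of `1` is
  -- used.
  let C : ℝ := (2 * R) ^ p * ((L : ℝ) ^ p * (2 * (d + 1))) + R ^ p * E + 1
  refine ⟨C, by positivity, fun r hr => ?_⟩
  have hrp : 0 < r ^ (-p) := by positivity
  rcases lt_or_ge r R with hrR | hrR
  · refine ⟨Set.indicator {1} fun _ => 1, ?_, ?_, ?_⟩
    · intro x hx
      have : x = 1 := by
        by_contra h
        simp [h] at hx
      simp [this, ball, hr.le]
    · rw [tsum_eq_single 1]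
      · simp
      · intro x hx
        simp [hx, Real.zero_rpow hp.ne']
    · have h1 : 1 ≤ R ^ p * r ^ (-p) := by
        rw [Real.rpow_neg hr.le, ← div_eq_mul_inv, one_le_div (by positivity)]
        exact Real.rpow_le_rpow hr.le hrR.le hp.le
      calc E ≤ E * (R ^ p * r ^ (-p)) := le_mul_of_one_le_right hE h1
        _ = R ^ p * E * r ^ (-p) := by ring
        _ ≤ C * r ^ (-p) := by
          refine mul_le_mul_of_nonneg_right ?_ hrp.le
          have : 0 ≤ (2 * R) ^ p * ((L : ℝ) ^ p * (2 * (d + 1))) := by positivity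
          simp only [C]; linarith
  · have h1R : 1 ≤ r / R := (one_le_div hR).2 hrR
    have hm : 1 ≤ ⌊r / R⌋₊ := (Nat.one_le_floor_iff _).2 h1R
    set m := ⌊r / R⌋₊
    have hm0 : (1 : ℝ) ≤ m := by exact_mod_cast hm
    have hmr : r ≤ 2 * R * m := by
      have := Nat.lt_floor_add_one (r / R)
      have h2 : r / R ≤ 2 * m := by linarith
      rw [div_le_iff₀ hR] at h2
      linarith
    have hmR : (m : ℝ) * R ≤ r := (le_div_iff₀ hR).1 (Nat.floor_le (by positivity))
    obtain ⟨f, X, hXne, hfX, hXball, hLip, hle⟩ := hκ m hm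
    set N : ℝ := ∑ x ∈ X, |f x| ^ p
    have hmp : (0 : ℝ) < (m : ℝ) ^ p := by positivity
    have hXpos : (0 : ℝ) < X.card := by exact_mod_cast hXne.card_pos
    have hN : 0 < N := by
      have : 0 < 2 * (d + 1) * N := (mul_pos hmp hXpos).trans_le hle
      exact pos_of_mul_pos_right this (by positivity)
    set c : ℝ := N ^ (-1 / p)
    have hc : 0 < c := by positivity
    have hcp : c ^ p = N⁻¹ := by
      rw [← Real.rpow_mul hN.le, div_mul_cancel₀ _ hp.ne', Real.rpow_neg_one]
    have hsupp : Function.support (fun x => c * f x) ⊆ X := fun x hx => by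
      rw [← hfX]
      exact right_ne_zero_of_mul hx
    refine ⟨fun x => c * f x, fun x hx => ?_, ?_, ?_⟩
    · have h1 := hXball x (hsupp hx)
      have h2 : wordLength S x ≤ M * (κ * m) := (hM x).trans (Nat.mul_le_mul_left _ h1)
      have h3 : (wordLength S x : ℝ) ≤ M * (κ * m) := by exact_mod_cast h2
      have h4 : (M : ℝ) * (κ * m) ≤ m * R := by simp only [R]; nlinarith
      exact h3.trans (h4.trans hmR)
    · rw [tsum_eq_sum (s := X)]
      · simp_rw [abs_mul, Real.mul_rpow (abs_nonneg _) (abs_nonneg _), abs_of_pos hc, hcp]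
        rw [← Finset.mul_sum]
        exact inv_mul_cancel₀ hN.ne'
      · intro x hx
        have : c * f x = 0 := by
          by_contra h
          exact hx (hsupp h)
        simp [this, Real.zero_rpow hp.ne']
    · have h1 : energy μ p (fun x => c * f x) ≤ (c * L) ^ p * X.card := by
        refine energy_le hμ hp hsupp fun x y hy => ?_
        rw [← mul_sub, abs_mul, abs_of_pos hc]
        gcongr
        exact (hLip x y).trans (by exact_mod_cast hL y hy)
      refine h1.trans ?_
      rw [Real.mul_rpow hc.le (by positivity), hcp]
      have h2 : N⁻¹ * X.card ≤ 2 * (d + 1) * ((m : ℝ) ^ p)⁻¹ := by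
        rw [inv_mul_eq_div, ← div_eq_mul_inv, div_le_div_iff₀ hN hmp]
        linarith
      have h3 : ((m : ℝ) ^ p)⁻¹ ≤ (2 * R) ^ p * r ^ (-p) := by
        rw [Real.rpow_neg hr.le, ← div_eq_mul_inv, inv_eq_one_div, div_le_div_iff₀ hmp (by positivity),
          one_mul, ← Real.mul_rpow (by positivity) (by positivity)]
        exact Real.rpow_le_rpow hr.le hmr hp.le
      calc N⁻¹ * (L : ℝ) ^ p * X.card = (L : ℝ) ^ p * (N⁻¹ * X.card) := by ring
        _ ≤ (L : ℝ) ^ p * (2 * (d + 1) * ((2 * R) ^ p * r ^ (-p))) := by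
            refine mul_le_mul_of_nonneg_left (h2.trans ?_) (by positivity)
            gcongr
        _ = (2 * R) ^ p * ((L : ℝ) ^ p * (2 * (d + 1))) * r ^ (-p) := by ring
        _ ≤ C * r ^ (-p) := by
          refine mul_le_mul_of_nonneg_right ?_ hrp.le
          have : 0 ≤ R ^ p * E := by positivity
          simp only [C]; linarith

theorem lpProfile_le {S : Finset G} {μ : PMF G} {p r : ℝ} {f : G → ℝ}
    (hf : Function.support f ⊆ ball S r) (h1 : ∑' x, |f x| ^ p = 1) :
    lpProfile S μ p r ≤ energy μ p f := by
  refine csInf_le ⟨0, ?_⟩ ⟨f, hf, by rw [h1, Real.one_rpow], rfl⟩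
  rintro _ ⟨g, -, -, rfl⟩
  exact energy_nonneg μ p g

end ANGroup

namespace ANGroup

/-! ### Quadratic forms of powers of symmetric matrices. -/

section Matrix

open Matrix

variable {ι : Type*} [Fintype ι] [DecidableEq ι]

omit [DecidableEq ι] in
theorem dotProduct_sq_le (v w : ι → ℝ) : (v ⬝ᵥ w) ^ 2 ≤ (v ⬝ᵥ v) * (w ⬝ᵥ w) := by
  have := Finset.sum_mul_sq_le_sq_mul_sq Finset.univ v w
  simpa only [dotProduct, ← sq] using this

omit [DecidableEq ι] in
theorem mulVec_dotProduct_of_isSymm {A : Matrix ι ι ℝ} (hA : A.IsSymm) (v w : ι → ℝ) :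
    (A *ᵥ v) ⬝ᵥ w = v ⬝ᵥ (A *ᵥ w) := by
  rw [dotProduct_mulVec, ← mulVec_transpose, hA.eq]

/-- Log-convexity of `n ↦ ⟨f, A ^ (2 n) f⟩` for a symmetric matrix `A`. -/
theorem pow_le_dotProduct_pow {A : Matrix ι ι ℝ} (hA : A.IsSymm) {f : ι → ℝ} (hf : f ⬝ᵥ f = 1)
    (n : ℕ) : (f ⬝ᵥ (A *ᵥ f)) ^ (2 * n) ≤ (A ^ n *ᵥ f) ⬝ᵥ (A ^ n *ᵥ f) := by
  set b : ℕ → ℝ := fun k => (A ^ k *ᵥ f) ⬝ᵥ (A ^ k *ᵥ f)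
  have hb0 : b 0 = 1 := by simp [b, hf]
  have hbn : ∀ k, 0 ≤ b k := fun k => by
    simpa using dotProduct_star_self_nonneg (A ^ k *ᵥ f)
  have hsucc : ∀ k, A ^ (k + 1) *ᵥ f = A *ᵥ (A ^ k *ᵥ f) := fun k => by
    rw [mulVec_mulVec, pow_succ']
  have hconv : ∀ k, b (k + 1) ^ 2 ≤ b k * b (k + 2) := fun k => by
    have h1 : b (k + 1) = (A ^ k *ᵥ f) ⬝ᵥ (A ^ (k + 2) *ᵥ f) := by
      simp only [b]
      rw [hsucc (k + 1), hsucc k, mulVec_dotProduct_of_isSymm hA]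
    rw [h1]
    exact dotProduct_sq_le _ _
  -- By log-convexity the ratios `b (k+1) / b k` do not decrease; the product form also covers `b k
  -- = 0`.
  have hstep : ∀ k, b 1 * b k ≤ b (k + 1) := by
    intro k
    induction k with
    | zero => simp [hb0]
    | succ k ih =>
      rcases (hbn k).eq_or_lt with h | h
      · have h2 := hconv k
        rw [← h, zero_mul] at h2
        have h3 : b (k + 1) = 0 := pow_eq_zero_iff two_ne_zero |>.1 (h2.antisymm (sq_nonneg _))
        rw [h3, mul_zero]
        exact hbn _
      · refine le_of_mul_le_mul_left ?_ h
        calc b k * (b 1 * b (k + 1)) = (b 1 * b k) * b (k + 1) := by ring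
          _ ≤ b (k + 1) * b (k + 1) := mul_le_mul_of_nonneg_right ih (hbn _)
          _ = b (k + 1) ^ 2 := (sq _).symm
          _ ≤ _ := hconv k
  have hpow : ∀ k, b 1 ^ k ≤ b k := by
    intro k
    induction k with
    | zero => simp [hb0]
    | succ k ih =>
      rw [pow_succ']
      exact (mul_le_mul_of_nonneg_left ih (hbn 1)).trans (hstep k)
  refine le_trans ?_ (hpow n)
  rw [pow_mul]
  refine pow_le_pow_left₀ (sq_nonneg _) ?_ n
  have := dotProduct_sq_le f (A *ᵥ f)
  rw [hf, one_mul] at this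
  simpa [b] using this

theorem dotProduct_pow_eq {A : Matrix ι ι ℝ} (hA : A.IsSymm) (f : ι → ℝ) (n : ℕ) :
    (A ^ n *ᵥ f) ⬝ᵥ (A ^ n *ᵥ f) = f ⬝ᵥ (A ^ (2 * n) *ᵥ f) := by
  rw [mulVec_dotProduct_of_isSymm (hA.pow n), mulVec_mulVec, ← pow_add, two_mul]

omit [DecidableEq ι] in
-- Schur's test: `f i * f j ≤ (f i ^ 2 + f j ^ 2) / 2`, and by symmetry both halves give the same
-- sum.
theorem dotProduct_mulVec_le_sum_row {A : Matrix ι ι ℝ} (hA : A.IsSymm) (h0 : ∀ i j, 0 ≤ A i j)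
    (f : ι → ℝ) : f ⬝ᵥ (A *ᵥ f) ≤ ∑ i, f i ^ 2 * ∑ j, A i j := by
  have h1 : f ⬝ᵥ (A *ᵥ f) = ∑ i, ∑ j, A i j * (f i * f j) := by
    simp only [dotProduct, mulVec, Finset.mul_sum]
    exact Finset.sum_congr rfl fun i _ => Finset.sum_congr rfl fun j _ => by ring
  have h2 : ∑ i, ∑ j, A i j * f j ^ 2 = ∑ i, ∑ j, A i j * f i ^ 2 := by
    rw [Finset.sum_comm]
    exact Finset.sum_congr rfl fun i _ => Finset.sum_congr rfl fun j _ => by rw [hA.apply]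
  have h3 : ∑ i, f i ^ 2 * ∑ j, A i j = ∑ i, ∑ j, A i j * f i ^ 2 :=
    Finset.sum_congr rfl fun i _ => by rw [← Finset.sum_mul, mul_comm]
  have h4 : ∑ i, ∑ j, A i j * (f i * f j) ≤
      ∑ i, ∑ j, (1 / 2 * (A i j * f i ^ 2) + 1 / 2 * (A i j * f j ^ 2)) :=
    Finset.sum_le_sum fun i _ => Finset.sum_le_sum fun j _ => by
      nlinarith [mul_nonneg (h0 i j) (sq_nonneg (f i - f j))]
  simp only [Finset.sum_add_distrib, ← Finset.mul_sum] at h4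
  rw [h2] at h4
  rw [h1, h3]
  linarith

/-- Cauchy-Schwarz on row `i` of `A ^ n`, whose squared norm is `(A ^ (2 * n)) i i`. -/
theorem dotProduct_pow_le_trace {A : Matrix ι ι ℝ} (hA : A.IsSymm) {f : ι → ℝ}
    (hf : f ⬝ᵥ f = 1) (n : ℕ) :
    (A ^ n *ᵥ f) ⬝ᵥ (A ^ n *ᵥ f) ≤ ∑ i, (A ^ (2 * n)) i i := by
  refine Finset.sum_le_sum fun i _ => ?_
  have h1 : (A ^ (2 * n)) i i = (A ^ n) i ⬝ᵥ (A ^ n) i := by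
    rw [two_mul, pow_add, mul_apply, dotProduct]
    exact Finset.sum_congr rfl fun j _ => by rw [(hA.pow n).apply]
  have h2 := dotProduct_sq_le ((A ^ n) i) f
  rw [hf, mul_one, ← h1, sq] at h2
  exact h2

end Matrix

variable {G : Type*} [Group G]

/-! ### The killed walk -/

theorem position_congr {n : ℕ} {ω ω' : ℕ → G} (h : ∀ i < n, ω i = ω' i) :
    position ω n = position ω' n := by
  induction n with
  | zero => rfl
  | succ n ih =>
    rw [position, position, ih fun i hi => h i (hi.trans n.lt_succ_self), h n n.lt_succ_self]

section Law

variable [MeasurableSpace G]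

instance (μ : PMF G) : IsProbabilityMeasure (incrementLaw μ) := by
  unfold incrementLaw; infer_instance

/-- The set `E` of increment sequences depends on the first `n` increments only. -/
def DependsOnFirst (n : ℕ) (E : Set (ℕ → G)) : Prop :=
  ∀ ω ω', (∀ i < n, ω i = ω' i) → ω ∈ E → ω' ∈ E

omit [Group G] [MeasurableSpace G] in
-- Such an event is pulled back from a finite product of copies of `G`; its measurability and its
-- independence of increment `n` both rest on this.
theorem DependsOnFirst.preimage_image {n : ℕ} {E : Set (ℕ → G)} (hE : DependsOnFirst n E) :
    (fun (ω : ℕ → G) (i : Finset.range n) => ω i) ⁻¹'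
      ((fun (ω : ℕ → G) (i : Finset.range n) => ω i) '' E) = E := by
  refine Set.Subset.antisymm ?_ (Set.subset_preimage_image _ _)
  rintro ω ⟨ω', hω', h⟩
  exact hE ω' ω (fun i hi => congrFun h ⟨i, Finset.mem_range.2 hi⟩) hω'

variable [DiscreteMeasurableSpace G] [Countable G]

omit [Group G] in
theorem DependsOnFirst.measurableSet {n : ℕ} {E : Set (ℕ → G)} (hE : DependsOnFirst n E) :
    MeasurableSet E := by
  rw [← hE.preimage_image]
  exact (by fun_prop : Measurable fun (ω : ℕ → G) (i : Finset.range n) => ω i)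
    (MeasurableSet.of_discrete)

omit [Group G] in
theorem DependsOnFirst.measureReal_inter (μ : PMF G) {n : ℕ} {E : Set (ℕ → G)}
    (hE : DependsOnFirst n E) (y : G) :
    (incrementLaw μ).real (E ∩ {ω | ω n = y}) = (incrementLaw μ).real E * (μ y).toReal := by
  have hind : ProbabilityTheory.iIndepFun (fun (i : ℕ) (ω : ℕ → G) => ω i) (incrementLaw μ) :=
    ProbabilityTheory.iIndepFun_infinitePi (P := fun _ : ℕ => μ.toMeasure) (X := fun _ x => x)
      fun _ => measurable_id
  have h := (hind.indepFun_finset (Finset.range n) {n} (by simp)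
    fun i => measurable_pi_apply i).measure_inter_preimage_eq_mul
      ((fun (ω : ℕ → G) (i : Finset.range n) => ω i) '' E)
      {v | v ⟨n, Finset.mem_singleton_self n⟩ = y} MeasurableSet.of_discrete
      MeasurableSet.of_discrete
  rw [hE.preimage_image] at h
  have h1 : (fun (ω : ℕ → G) (i : ({n} : Finset ℕ)) => ω i) ⁻¹'
      {v | v ⟨n, Finset.mem_singleton_self n⟩ = y} = {ω | ω n = y} := rfl
  have h2 : incrementLaw μ {ω | ω n = y} = μ y := by
    have h3 : {ω : ℕ → G | ω n = y} = (fun ω => ω n) ⁻¹' {y} := rfl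
    rw [h3, ← Measure.map_apply (measurable_pi_apply n) MeasurableSet.of_discrete, incrementLaw,
      Measure.infinitePi_map_eval, PMF.toMeasure_apply_singleton _ _ MeasurableSet.of_discrete]
  rw [h1, h2] at h
  rw [measureReal_def, h, ENNReal.toReal_mul, measureReal_def]

/-- The transition matrix of the walk killed outside `B`. -/
def killedMatrix (μ : PMF G) (B : Finset G) : Matrix B B ℝ :=
  Matrix.of fun x y => (μ ((x : G)⁻¹ * y)).toReal

omit [MeasurableSpace G] [DiscreteMeasurableSpace G] [Countable G] in
theorem killedMatrix_isSymm {μ : PMF G} (hμ : ∀ g, μ g⁻¹ = μ g) (B : Finset G) :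
    (killedMatrix μ B).IsSymm := by
  ext x y
  simp only [killedMatrix, Matrix.transpose_apply, Matrix.of_apply]
  rw [← hμ, mul_inv_rev, inv_inv]

/-- The walk started at `x` stays in `B` up to time `n` and is at `y` at time `n`. -/
def stayEvent (B : Finset G) (n : ℕ) (x y : G) : Set (ℕ → G) :=
  {ω | (∀ k ≤ n, x * position ω k ∈ B) ∧ x * position ω n = y}

omit [MeasurableSpace G] [DiscreteMeasurableSpace G] [Countable G] in
theorem dependsOnFirst_stayEvent (B : Finset G) (n : ℕ) (x y : G) :
    DependsOnFirst n (stayEvent B n x y) := by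
  rintro ω ω' h ⟨h1, h2⟩
  refine ⟨fun k hk => ?_, ?_⟩
  · rw [← position_congr fun i hi => h i (hi.trans_le hk)]
    exact h1 k hk
  · rwa [← position_congr h]

/-- Decompose by the position `z` at time `n`; the next increment is independent of the past. -/
theorem killedMatrix_pow_apply [DecidableEq G] (μ : PMF G) (B : Finset G) (n : ℕ) (x y : B) :
    (killedMatrix μ B ^ n) x y = (incrementLaw μ).real (stayEvent B n x y) := by
  induction n generalizing y with
  | zero =>
    rw [pow_zero, Matrix.one_apply]
    split_ifs with h
    · have : stayEvent B 0 (x : G) y = Set.univ := Set.eq_univ_of_forall fun ω => by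
        subst h
        refine ⟨fun k hk => ?_, by simp [position]⟩
        rw [Nat.le_zero.1 hk]
        simp [position]
      rw [this]
      simp
    · have : stayEvent B 0 (x : G) y = ∅ := Set.eq_empty_of_forall_notMem fun ω hω => by
        have := hω.2
        simp only [position, mul_one] at this
        exact h (Subtype.ext this)
      rw [this]
      simp
  | succ n ih =>
    have hset : stayEvent B (n + 1) (x : G) y = ⋃ z ∈ (Finset.univ : Finset B),
        stayEvent B n (x : G) z ∩ {ω | ω n = (z : G)⁻¹ * y} := by
      ext ω
      simp only [Set.mem_iUnion, Finset.mem_univ, exists_prop, true_and]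
      constructor
      · rintro ⟨h1, h2⟩
        refine ⟨⟨x * position ω n, h1 n n.le_succ⟩, ⟨fun k hk => h1 k (hk.trans n.le_succ), rfl⟩, ?_⟩
        change ω n = (x * position ω n : G)⁻¹ * y
        rw [← h2, position]
        group
      · rintro ⟨z, ⟨h1, h2⟩, h3⟩
        have h4 : x * position ω (n + 1) = (y : G) := by
          rw [position, ← mul_assoc, h2, (h3 : ω n = _), mul_inv_cancel_left]
        refine ⟨fun k hk => ?_, h4⟩
        rcases Nat.le_succ_iff.1 hk with hk | rfl
        · exact h1 k hk
        · rw [h4]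
          exact y.2
    rw [hset, measureReal_biUnion_finset, pow_succ, Matrix.mul_apply]
    · refine Finset.sum_congr rfl fun z _ => ?_
      rw [(dependsOnFirst_stayEvent B n x z).measureReal_inter, ih]
      rfl
    · intro z _ w _ hzw
      refine Set.disjoint_left.2 fun ω hz hw => hzw (Subtype.ext ?_)
      exact hz.1.2.symm.trans hw.1.2
    · exact fun z _ => (dependsOnFirst_stayEvent B n x z).measurableSet.inter
        (measurableSet_eq_fun (measurable_pi_apply n) measurable_const)

end Law

/-! ### Survival and return probabilities -/

/-- Expand the square in the energy: `f x ^ 2` and, by right translation, `f (x * y) ^ 2` both sum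
to 1, and the cross term is the quadratic form. -/
theorem dotProduct_killedMatrix {μ : PMF G} (hμ : μ.support.Finite) {B : Finset G} {f : G → ℝ}
    (hf : Function.support f ⊆ B) (h1 : ∑ x ∈ B, f x ^ 2 = 1) :
    (fun x : B => f x) ⬝ᵥ (Matrix.mulVec (killedMatrix μ B) fun x : B => f x) =
      1 - energy μ 2 f := by
  classical
  have hY : μ.support ⊆ hμ.toFinset := by simp
  set Y := hμ.toFinset
  have hf0 : ∀ x, x ∉ B → f x = 0 := fun x hx => by
    by_contra h
    exact hx (hf h)
  have hYμ : ∀ y, y ∉ Y → (μ y).toReal = 0 := fun y hy => by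
    have : μ y = 0 := by
      by_contra h
      exact hy (hY ((μ.mem_support_iff y).2 h))
    simp [this]
  rw [energy_eq_sum two_ne_zero hf hY]
  have hinner : ∀ y ∈ Y, ∑ x ∈ B ∪ B * Y⁻¹, |f x - f (x * y)| ^ (2 : ℝ) * (μ y).toReal =
      2 * (μ y).toReal - 2 * ∑ x ∈ B, f x * (f (x * y) * (μ y).toReal) := by
    intro y hy
    have e1 : ∑ x ∈ B ∪ B * Y⁻¹, f x ^ 2 = 1 := by
      rw [← h1]
      refine (Finset.sum_subset Finset.subset_union_left fun x _ hx => ?_).symm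
      simp [hf0 x hx]
    have e2 : ∑ x ∈ B ∪ B * Y⁻¹, f (x * y) ^ 2 = 1 := by
      rw [← h1, ← tsum_eq_sum (f := fun x => f (x * y) ^ 2) (L := SummationFilter.unconditional G),
        ← tsum_eq_sum (f := fun x => f x ^ 2) (s := B) (L := SummationFilter.unconditional G)]
      · exact (Equiv.mulRight y).tsum_eq fun x => f x ^ 2
      · intro x hx
        simp [hf0 x hx]
      · intro x hx
        rw [Finset.mem_union, not_or] at hx
        rw [hf0 (x * y), zero_pow two_ne_zero]
        exact fun h => hx.2 (Finset.mem_mul.2 ⟨x * y, h, y⁻¹, Finset.inv_mem_inv hy, by simp⟩)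
    have e3 : ∑ x ∈ B ∪ B * Y⁻¹, f x * f (x * y) = ∑ x ∈ B, f x * f (x * y) := by
      refine (Finset.sum_subset Finset.subset_union_left fun x _ hx => ?_).symm
      simp [hf0 x hx]
    have e4 : ∀ x, |f x - f (x * y)| ^ (2 : ℝ) = f x ^ 2 - 2 * (f x * f (x * y)) + f (x * y) ^ 2 := by
      intro x
      rw [Real.rpow_two, sq_abs]
      ring
    rw [← Finset.sum_mul]
    simp only [e4, Finset.sum_add_distrib, Finset.sum_sub_distrib, ← Finset.mul_sum, e1, e2, e3]
    simp only [← mul_assoc, ← Finset.sum_mul]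
    ring
  rw [Finset.sum_congr rfl hinner, Finset.sum_sub_distrib, ← Finset.mul_sum, ← Finset.mul_sum,
    sum_toReal_eq_one μ hY, Finset.sum_comm]
  simp only [← Finset.mul_sum]
  have hrow : ∀ x : G, ∑ y ∈ Y, f (x * y) * (μ y).toReal =
      ∑ z : B, (μ (x⁻¹ * z)).toReal * f z := by
    intro x
    rw [Finset.sum_coe_sort B fun z => (μ (x⁻¹ * z)).toReal * f z,
      ← tsum_eq_sum (f := fun y => f (x * y) * (μ y).toReal) (L := SummationFilter.unconditional G),
      ← tsum_eq_sum (f := fun z => (μ (x⁻¹ * z)).toReal * f z) (s := B)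
        (L := SummationFilter.unconditional G),
      ← (Equiv.mulLeft x).tsum_eq fun z => (μ (x⁻¹ * z)).toReal * f z]
    · exact tsum_congr fun y => by simp [mul_comm]
    · intro z hz
      simp [hf0 z hz]
    · intro y hy
      simp [hYμ y hy]
  simp only [dotProduct, Matrix.mulVec, killedMatrix, Matrix.of_apply, hrow]
  rw [Finset.sum_coe_sort B fun x => f x * ∑ z : B, (μ (x⁻¹ * z)).toReal * f z]
  ring

section Bounds

variable [MeasurableSpace G] [DiscreteMeasurableSpace G] [Countable G]
  {S : Finset G} {μ : PMF G} {f : G → ℝ} {r : ℝ}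

/-- A row sum is the probability of staying in `B` from some `x ∈ B`; two points of `B` are within
`2r`, so the walk from `e` then stays within `2r`. A diagonal entry is at most the return
probability. -/
theorem pow_le_survival (hS : IsSymmGenerating S) (hμ : IsSimpleWalk μ)
    (hf : Function.support f ⊆ ball S r) (h1 : ∑' x, |f x| ^ (2 : ℝ) = 1) (n : ℕ) :
    (1 - energy μ 2 f) ^ (2 * n) ≤ (incrementLaw μ).real
      {ω | ∀ k ≤ 2 * n, (wordLength S (position ω k) : ℝ) ≤ 2 * r} ∧
    (1 - energy μ 2 f) ^ (2 * n) ≤ (ball S r).ncard * returnProb μ (2 * n) := by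
  classical
  let B : Finset G := (hS.finite_ball r).toFinset
  have hB : ∀ x, x ∈ B ↔ (wordLength S x : ℝ) ≤ r := fun x => by simp [B, ball]
  have hfB : Function.support f ⊆ B := by simpa [B] using hf
  have h2 : ∑ x ∈ B, f x ^ 2 = 1 := by
    rw [← h1, tsum_eq_sum (s := B)]
    · simp
    · intro x hx
      have : f x = 0 := by
        by_contra h
        exact hx (hfB h)
      simp [this]
  have hsymm := killedMatrix_isSymm hμ.symm B
  let v : B → ℝ := fun x => f x
  have hv : v ⬝ᵥ v = 1 := by
    rw [← h2, ← Finset.sum_coe_sort B fun x => f x ^ 2, dotProduct]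
    exact Finset.sum_congr rfl fun x _ => (sq _).symm
  have hpow := pow_le_dotProduct_pow hsymm hv n
  rw [dotProduct_killedMatrix hμ.finite_support hfB h2] at hpow
  have hentry : ∀ x y, (killedMatrix μ B ^ (2 * n)) x y =
      (incrementLaw μ).real (stayEvent B (2 * n) x y) := fun x y =>
    killedMatrix_pow_apply μ B (2 * n) x y
  constructor
  · set q := (incrementLaw μ).real
      {ω | ∀ k ≤ 2 * n, (wordLength S (position ω k) : ℝ) ≤ 2 * r}
    have hrow : ∀ x : B, ∑ y, (killedMatrix μ B ^ (2 * n)) x y ≤ q := by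
      intro x
      simp only [hentry]
      rw [← measureReal_biUnion_finset]
      · refine measureReal_mono fun ω hω k hk => ?_
        obtain ⟨y, -, hy⟩ := Set.mem_iUnion₂.1 hω
        have h3 := hS.wordLength_mul_le (x : G)⁻¹ (x * position ω k)
        rw [inv_mul_cancel_left, hS.wordLength_inv] at h3
        have h4 : (wordLength S (position ω k) : ℝ) ≤
            wordLength S (x : G) + wordLength S (x * position ω k) := by exact_mod_cast h3
        have h5 := (hB x).1 x.2
        have h6 := (hB _).1 (hy.1 k hk)
        linarith
      · intro z _ w _ hzw
        refine Set.disjoint_left.2 fun ω hz hw => hzw (Subtype.ext ?_)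
        exact hz.2.symm.trans hw.2
      · exact fun y _ => (dependsOnFirst_stayEvent B (2 * n) x y).measurableSet
    rw [dotProduct_pow_eq hsymm] at hpow
    refine hpow.trans ((dotProduct_mulVec_le_sum_row (hsymm.pow _) (fun x y => ?_) v).trans ?_)
    · rw [hentry]
      exact measureReal_nonneg
    · calc ∑ x, v x ^ 2 * ∑ y, (killedMatrix μ B ^ (2 * n)) x y ≤ ∑ x, v x ^ 2 * q :=
            Finset.sum_le_sum fun x _ => mul_le_mul_of_nonneg_left (hrow x) (sq_nonneg _)
        _ = (v ⬝ᵥ v) * q := by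
            rw [← Finset.sum_mul, dotProduct]
            simp only [sq]
        _ = q := by rw [hv, one_mul]
  · refine hpow.trans ((dotProduct_pow_le_trace hsymm hv n).trans ?_)
    calc ∑ x : B, (killedMatrix μ B ^ (2 * n)) x x ≤ ∑ x : B, returnProb μ (2 * n) := by
          refine Finset.sum_le_sum fun x _ => ?_
          rw [hentry]
          exact measureReal_mono fun ω hω => mul_eq_left.1 hω.2
      _ = (ball S r).ncard * returnProb μ (2 * n) := by
          rw [Finset.sum_const, nsmul_eq_mul, Finset.card_univ, Fintype.card_coe,
            Set.ncard_eq_toFinset_card _ (hS.finite_ball r)]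

end Bounds

end ANGroup

namespace ANGroup

/-! ### Elementary bounds, and positivity at small times. -/

theorem exp_neg_two_mul_le {x : ℝ} (h0 : 0 ≤ x) (h1 : x ≤ 1 / 2) : Real.exp (-(2 * x)) ≤ 1 - x := by
  have h2 := Real.add_one_le_exp (2 * x)
  rw [Real.exp_neg, inv_le_comm₀ (Real.exp_pos _) (by linarith)]
  refine le_trans ?_ h2
  rw [inv_le_iff_one_le_mul₀ (by linarith)]
  nlinarith

theorem exists_pos_le_of_lt {Q : ℕ → Prop} {F : ℕ → ℝ} (h : ∀ n, Q n → 0 < F n) (N : ℕ) :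
    ∃ p : ℝ, 0 < p ∧ ∀ n < N, Q n → p ≤ F n := by
  induction N with
  | zero => exact ⟨1, one_pos, by simp⟩
  | succ N ih =>
    obtain ⟨p, hp, hpn⟩ := ih
    by_cases hQ : Q N
    · refine ⟨min p (F N), lt_min hp (h N hQ), fun n hn hQn => ?_⟩
      rcases Nat.lt_succ_iff_lt_or_eq.1 hn with hn | rfl
      · exact (min_le_left _ _).trans (hpn n hn hQn)
      · exact min_le_right _ _
    · refine ⟨p, hp, fun n hn hQn => ?_⟩
      rcases Nat.lt_succ_iff_lt_or_eq.1 hn with hn | rfl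
      · exact hpn n hn hQn
      · exact absurd hQn hQ

variable {G : Type*} [Group G] [MeasurableSpace G] [DiscreteMeasurableSpace G]

section Positivity

variable [Countable G]

omit [MeasurableSpace G] [DiscreteMeasurableSpace G] [Countable G] in
theorem dependsOnFirst_position (n : ℕ) (A : Set G) :
    DependsOnFirst n {ω | position ω n ∈ A} := fun ω ω' h hω => by
  have : position ω' n = position ω n := (position_congr h).symm
  simpa [this] using hω

theorem measureReal_position_inter (μ : PMF G) (n : ℕ) (g y : G) :
    (incrementLaw μ).real ({ω | position ω n = g} ∩ {ω | ω n = y}) =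
      (incrementLaw μ).real {ω | position ω n = g} * (μ y).toReal :=
  (dependsOnFirst_position n {g}).measureReal_inter μ y

theorem measureReal_position_succ_ge (μ : PMF G) (n : ℕ) (g y : G) :
    (incrementLaw μ).real {ω | position ω n = g * y⁻¹} * (μ y).toReal ≤
      (incrementLaw μ).real {ω | position ω (n + 1) = g} := by
  rw [← measureReal_position_inter]
  refine measureReal_mono ?_
  rintro ω ⟨h1, h2⟩
  simp only [Set.mem_ofPred_eq] at h1 h2 ⊢
  rw [position, h1, h2, inv_mul_cancel_right]

theorem exists_pos_of_position_succ {μ : PMF G} {n : ℕ} {g : G}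
    (h : 0 < (incrementLaw μ).real {ω | position ω (n + 1) = g}) :
    ∃ y, 0 < (incrementLaw μ).real {ω | position ω n = g * y⁻¹} ∧ 0 < (μ y).toReal := by
  by_contra! hcon
  have hnull : ∀ y, incrementLaw μ ({ω | position ω n = g * y⁻¹} ∩ {ω | ω n = y}) = 0 := by
    intro y
    rw [← measureReal_eq_zero_iff, measureReal_position_inter]
    by_cases hy : 0 < (incrementLaw μ).real {ω | position ω n = g * y⁻¹}
    · rw [(hcon y hy).antisymm ENNReal.toReal_nonneg, mul_zero]
    · rw [(not_lt.1 hy).antisymm measureReal_nonneg, zero_mul]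
  refine h.ne' ((measureReal_eq_zero_iff).2 (measure_mono_null ?_ (measure_iUnion_null hnull)))
  intro ω hω
  refine Set.mem_iUnion.2 ⟨ω n, ?_, rfl⟩
  simp only [Set.mem_ofPred_eq, position] at hω ⊢
  rw [← hω, mul_inv_cancel_right]

/-- Return to `1` at time `n`, then follow a fixed path of positive probability to `g`; `c` is the
probability of that path, found by peeling off last steps. -/
theorem exists_pos_mul_returnProb_le {μ : PMF G} (j : ℕ) {g : G}
    (h : 0 < (incrementLaw μ).real {ω | position ω j = g}) :
    ∃ c : ℝ, 0 < c ∧ ∀ n,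
      c * returnProb μ n ≤ (incrementLaw μ).real {ω | position ω (n + j) = g} := by
  induction j generalizing g with
  | zero =>
    have hg : g = 1 := by
      by_contra hg
      have : {ω : ℕ → G | position ω 0 = g} = ∅ :=
        Set.eq_empty_of_forall_notMem fun ω hω => hg (Eq.symm hω)
      simp [this] at h
    subst hg
    exact ⟨1, one_pos, fun n => (one_mul _).le⟩
  | succ j ih =>
    obtain ⟨y, hy, hμy⟩ := exists_pos_of_position_succ h
    obtain ⟨c, hc, hcn⟩ := ih hy
    refine ⟨c * (μ y).toReal, mul_pos hc hμy, fun n => ?_⟩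
    calc c * (μ y).toReal * returnProb μ n = c * returnProb μ n * (μ y).toReal := by ring
      _ ≤ _ := mul_le_mul_of_nonneg_right (hcn n) hμy.le
      _ ≤ _ := measureReal_position_succ_ge μ (n + j) g y

/-- With positive probability the walk alternates between `1` and `g`. -/
theorem alternating_pos {μ : PMF G} (hμ : ∀ g, μ g⁻¹ = μ g) {g : G} (hg : g ∈ μ.support) (n : ℕ) :
    0 < (incrementLaw μ).real {ω | ∀ k ≤ n, position ω k = if Even k then 1 else g} := by
  have hμg : 0 < (μ g).toReal :=
    ENNReal.toReal_pos ((μ.mem_support_iff g).1 hg) (μ.apply_ne_top g)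
  induction n with
  | zero =>
    have : {ω : ℕ → G | ∀ k ≤ 0, position ω k = if Even k then 1 else g} = Set.univ :=
      Set.eq_univ_of_forall fun ω k hk => by simp [Nat.le_zero.1 hk, position]
    rw [this]
    simp
  | succ n ih =>
    have hdep : DependsOnFirst n
        {ω : ℕ → G | ∀ k ≤ n, position ω k = if Even k then 1 else g} := fun ω ω' h hω k hk => by
      rw [← position_congr fun i hi => h i (hi.trans_le hk)]
      exact hω k hk
    refine lt_of_lt_of_le ?_ (measureReal_mono (s₁ := {ω : ℕ → G | ∀ k ≤ n, position ω k =
      if Even k then 1 else g} ∩ {ω | ω n = if Even n then g else g⁻¹}) ?_)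
    · rw [hdep.measureReal_inter]
      refine mul_pos ih ?_
      split_ifs
      · exact hμg
      · rwa [hμ]
    · rintro ω ⟨h1, h2⟩ k hk
      rcases Nat.le_succ_iff.1 hk with hk | rfl
      · exact h1 k hk
      · rw [position, h1 n le_rfl, (h2 : ω n = _)]
        by_cases he : Even n
        · simp [he, Nat.even_add_one]
        · simp [he, Nat.even_add_one]

theorem returnProb_pos_of_even {μ : PMF G} (hμ : ∀ g, μ g⁻¹ = μ g) {n : ℕ} (hn : Even n) :
    0 < returnProb μ n := by
  obtain ⟨g, hg⟩ := μ.support_nonempty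
  refine (alternating_pos hμ hg n).trans_le (measureReal_mono fun ω hω => ?_)
  have := hω n le_rfl
  rwa [if_pos hn] at this

end Positivity

/-! ### Caution, return probability and diffusivity. -/

variable {S : Finset G} {μ : PMF G}

/-- A test function in the ball of radius `r / 2` confines the walk to radius `r`, at the price of a
factor 4. The condition `C / r ^ 2 ≤ 1` makes the base nonnegative, so that powers are monotone. -/
theorem exists_survival_bound [Countable G] (hG : IsAmenable G) (hdim : HasFiniteANDim G)
    (hS : IsSymmGenerating S) (hμ : IsSimpleWalk μ) :
    ∃ C : ℝ, 0 < C ∧ ∀ r : ℝ, 0 < r → C / r ^ 2 ≤ 1 → ∀ n : ℕ,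
      (1 - C / r ^ 2) ^ (2 * n) ≤ (incrementLaw μ).real
        {ω | ∀ k ≤ 2 * n, (wordLength S (position ω k) : ℝ) ≤ r} ∧
      (1 - C / r ^ 2) ^ (2 * n) ≤ (ball S r).ncard * returnProb μ (2 * n) := by
  obtain ⟨C, hC, h⟩ := exists_energy_le hG hdim hS hμ.finite_support (p := 2) two_pos
  refine ⟨4 * C, by positivity, fun r hr hle n => ?_⟩
  obtain ⟨f, hf, h1, hE⟩ := h (r / 2) (by positivity)
  have hE' : energy μ 2 f ≤ 4 * C / r ^ 2 := by
    refine hE.trans_eq ?_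
    rw [Real.rpow_neg (by positivity), Real.rpow_two]
    field_simp
    norm_num
  have hpow : (1 - 4 * C / r ^ 2) ^ (2 * n) ≤ (1 - energy μ 2 f) ^ (2 * n) :=
    pow_le_pow_left₀ (by linarith) (by linarith) _
  obtain ⟨h2, h3⟩ := pow_le_survival hS hμ hf h1 n
  rw [mul_div_cancel₀ r two_ne_zero] at h2
  refine ⟨hpow.trans h2, (hpow.trans h3).trans ?_⟩
  refine mul_le_mul_of_nonneg_right ?_ measureReal_nonneg
  exact_mod_cast Set.ncard_le_ncard
    (fun g (hg : (wordLength S g : ℝ) ≤ r / 2) => show (wordLength S g : ℝ) ≤ r by linarith)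
    (hS.finite_ball r)

theorem isTotallyCautious [Countable G] (hG : IsAmenable G) (hdim : HasFiniteANDim G)
    (hS : IsSymmGenerating S) (hμ : IsSimpleWalk μ) : IsTotallyCautious S μ := by
  obtain ⟨C, hC, h⟩ := exists_survival_bound hG hdim hS hμ
  intro ε hε
  set F : ℕ → ℝ := fun n => (incrementLaw μ).real
      {ω | ∀ k, 1 ≤ k → k ≤ n → (wordLength S (position ω k) : ℝ) ≤ ε * √n}
  have hpos : ∀ n : ℕ, (∃ g ∈ μ.support, (wordLength S g : ℝ) ≤ ε * √n) → 0 < F n := by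
    rintro n ⟨g, hg, hgn⟩
    refine (alternating_pos hμ.symm hg n).trans_le (measureReal_mono fun ω hω k _ hk => ?_)
    rw [hω k hk]
    split_ifs
    · simp only [wordLength_one, Nat.cast_zero]
      positivity
    · exact hgn
  -- Beyond this threshold `C / (ε√n)² ≤ 1/2`; the finitely many smaller `n` use the alternating
  -- path.
  obtain ⟨p, hp, hpn⟩ := exists_pos_le_of_lt hpos (⌈2 * C / ε ^ 2⌉₊ + 1)
  refine ⟨min p (Real.exp (-(4 * C / ε ^ 2))), lt_min hp (Real.exp_pos _), fun n hn hgn => ?_⟩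
  rcases lt_or_ge n (⌈2 * C / ε ^ 2⌉₊ + 1) with hlt | hge
  · exact (min_le_left _ _).trans (hpn n hlt hgn)
  · refine (min_le_right _ _).trans ?_
    have hn0 : (0 : ℝ) < n := by exact_mod_cast hn
    have hnC : 2 * C / ε ^ 2 ≤ n := (Nat.le_ceil _).trans (by exact_mod_cast (by omega))
    have hsq : (ε * √n) ^ 2 = ε ^ 2 * n := by rw [mul_pow, Real.sq_sqrt hn0.le]
    have hl : C / (ε * √n) ^ 2 ≤ 1 / 2 := by
      rw [hsq, div_le_iff₀ (by positivity)]
      rw [div_le_iff₀ (by positivity)] at hnC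
      linarith
    obtain ⟨h1, -⟩ := h (ε * √n) (by positivity) (by linarith) n
    calc Real.exp (-(4 * C / ε ^ 2)) = Real.exp (-(2 * (C / (ε * √n) ^ 2))) ^ (2 * n) := by
          rw [← Real.exp_nat_mul, hsq]
          congr 1
          push_cast
          field_simp
          ring
      _ ≤ (1 - C / (ε * √n) ^ 2) ^ (2 * n) :=
          pow_le_pow_left₀ (Real.exp_pos _).le (exp_neg_two_mul_le (by positivity) hl) _
      _ ≤ _ := h1
      _ ≤ F n := measureReal_mono fun ω hω k _ hk => hω k (by omega)

theorem exists_returnProb_even_ge [Countable G] (hG : IsAmenable G) (hdim : HasFiniteANDim G)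
    (hS : IsSymmGenerating S) (hμ : IsSimpleWalk μ) :
    ∃ C : ℝ, 0 ≤ C ∧ ∀ n : ℕ, Even n →
      Real.exp (-C * (n : ℝ) ^ (1 / 3 : ℝ)) ≤ returnProb μ n := by
  obtain ⟨C, hC, h⟩ := exists_survival_bound hG hdim hS hμ
  -- For `n ≥ N` the radius `r = n^(1/3)` is at least `2C + 1`, hence `C / r ^ 2 ≤ 1/2`.
  set N := ⌈(2 * C + 1) ^ 3⌉₊
  obtain ⟨p, hp, hpn⟩ := exists_pos_le_of_lt (Q := Even) (F := returnProb μ)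
    (fun n hn => returnProb_pos_of_even hμ.symm hn) N
  set s : ℝ := S.card + 1
  have hs : 1 ≤ s := by simp [s]
  have hlogs : 0 ≤ Real.log s := Real.log_nonneg hs
  refine ⟨2 * C + Real.log s + |Real.log p|, by positivity, fun n hn => ?_⟩
  rcases Nat.eq_zero_or_pos n with rfl | hn0
  · have : returnProb μ 0 = 1 := by
      have : {ω : ℕ → G | position ω 0 = 1} = Set.univ := Set.eq_univ_of_forall fun ω => rfl
      rw [returnProb, this]
      simp
    rw [this]
    simp
  have hn1 : (1 : ℝ) ≤ n := by exact_mod_cast hn0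
  set r : ℝ := (n : ℝ) ^ (1 / 3 : ℝ)
  have hr1 : 1 ≤ r := Real.one_le_rpow hn1 (by norm_num)
  have hr3 : r ^ 3 = n := by
    rw [← Real.rpow_natCast, ← Real.rpow_mul (by positivity)]
    norm_num
  rcases lt_or_ge n N with hlt | hge
  · refine le_trans ?_ (hpn n hlt hn)
    rw [← Real.exp_log hp, Real.exp_le_exp, Real.log_exp]
    have h1 := neg_abs_le (Real.log p)
    have h2 : |Real.log p| ≤ |Real.log p| * r := le_mul_of_one_le_right (abs_nonneg _) hr1
    nlinarith
  · have hCr : 2 * C + 1 ≤ r := by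
      have h1 : (2 * C + 1) ^ 3 ≤ r ^ 3 := by
        rw [hr3]
        exact (Nat.le_ceil _).trans (by exact_mod_cast hge)
      exact le_of_pow_le_pow_left₀ three_ne_zero (by positivity) h1
    have hl : C / r ^ 2 ≤ 1 / 2 := by
      rw [div_le_iff₀ (by positivity)]
      nlinarith
    obtain ⟨k, hk⟩ := hn
    obtain rfl : n = 2 * k := by omega
    obtain ⟨-, h1⟩ := h r (by positivity) (by linarith) k
    have h2 : Real.exp (-(2 * C * r)) ≤ (1 - C / r ^ 2) ^ (2 * k) := by
      refine le_trans (le_of_eq ?_)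
        (pow_le_pow_left₀ (Real.exp_pos _).le (exp_neg_two_mul_le (by positivity) hl) _)
      rw [← Real.exp_nat_mul, ← hr3]
      congr 1
      field_simp
    have h3 : ((ball S r).ncard : ℝ) ≤ Real.exp (Real.log s * r) := by
      have h4 : ((ball S r).ncard : ℝ) ≤ s ^ ⌊r⌋₊ := by
        have := hS.ncard_ball_le r
        simp only [s]
        exact_mod_cast this
      refine h4.trans ?_
      rw [← Real.rpow_def_of_pos (by positivity), ← Real.rpow_natCast]
      exact Real.rpow_le_rpow_of_exponent_le hs (Nat.floor_le (by positivity))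
    have h5 : Real.exp (-(2 * C * r)) ≤ Real.exp (Real.log s * r) * returnProb μ (2 * k) :=
      (h2.trans h1).trans (mul_le_mul_of_nonneg_right h3 measureReal_nonneg)
    calc Real.exp (-(2 * C + Real.log s + |Real.log p|) * r)
        ≤ Real.exp (-(Real.log s * r)) * Real.exp (-(2 * C * r)) := by
          rw [← Real.exp_add, Real.exp_le_exp]
          have : 0 ≤ |Real.log p| * r := by positivity
          linarith
      _ ≤ Real.exp (-(Real.log s * r)) * (Real.exp (Real.log s * r) * returnProb μ (2 * k)) := by
          gcongr
      _ = returnProb μ (2 * k) := by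
          rw [← mul_assoc, ← Real.exp_add, neg_add_cancel, Real.exp_zero, one_mul]

theorem exists_returnProb_ge [Countable G] (hG : IsAmenable G) (hdim : HasFiniteANDim G)
    (hS : IsSymmGenerating S) (hμ : IsSimpleWalk μ) :
    ∃ C : ℝ, ∀ n : ℕ, (Even n ∨ 0 < returnProb μ n) →
      Real.exp (-C * (n : ℝ) ^ (1 / 3 : ℝ)) ≤ returnProb μ n := by
  classical
  obtain ⟨C, hC, h⟩ := exists_returnProb_even_ge hG hdim hS hμ
  by_cases hodd : ∃ j, ¬ Even j ∧ 0 < returnProb μ j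
  · set j := Nat.find hodd
    obtain ⟨hj, hjpos⟩ := Nat.find_spec hodd
    obtain ⟨c, hc, hcn⟩ := exists_pos_mul_returnProb_le j hjpos
    refine ⟨C + |Real.log c|, fun n hn => ?_⟩
    by_cases he : Even n
    · refine le_trans (Real.exp_le_exp.2 ?_) (h n he)
      have : 0 ≤ |Real.log c| * (n : ℝ) ^ (1 / 3 : ℝ) := by positivity
      linarith
    · have hpos := hn.resolve_left he
      -- As `j` is the least odd return time, `n = m + j` with `m` even: return at time `m`, then
      -- follow a loop of length `j`.
      obtain ⟨m, rfl⟩ := Nat.exists_eq_add_of_le' (Nat.find_min' hodd ⟨he, hpos⟩)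
      change ¬ Even (m + j) at he
      change Real.exp (-(C + |Real.log c|) * ((m + j : ℕ) : ℝ) ^ (1 / 3 : ℝ)) ≤
        returnProb μ (m + j)
      have hm : Even m := by
        change ¬ Even j at hj
        rw [Nat.even_add] at he
        tauto
      have hj1 : 1 ≤ j := Nat.one_le_iff_ne_zero.2 fun h0 => by
        change ¬ Even j at hj
        exact hj (h0 ▸ Even.zero)
      have h1 : (1 : ℝ) ≤ (m + j : ℕ) := by exact_mod_cast hj1.trans (Nat.le_add_left _ _)
      have h2 : 1 ≤ ((m + j : ℕ) : ℝ) ^ (1 / 3 : ℝ) := Real.one_le_rpow h1 (by norm_num)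
      have h3 : (m : ℝ) ^ (1 / 3 : ℝ) ≤ ((m + j : ℕ) : ℝ) ^ (1 / 3 : ℝ) :=
        Real.rpow_le_rpow (by positivity) (by push_cast; linarith [Nat.cast_nonneg (α := ℝ) j])
          (by norm_num)
      calc Real.exp (-(C + |Real.log c|) * ((m + j : ℕ) : ℝ) ^ (1 / 3 : ℝ))
          ≤ Real.exp (Real.log c) * Real.exp (-C * (m : ℝ) ^ (1 / 3 : ℝ)) := by
            rw [← Real.exp_add, Real.exp_le_exp]
            have h4 := neg_abs_le (Real.log c)
            have h5 := le_mul_of_one_le_right (abs_nonneg (Real.log c)) h2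
            have h6 := mul_le_mul_of_nonneg_left h3 hC
            linarith
        _ ≤ c * returnProb μ m := by
            rw [Real.exp_log hc]
            exact mul_le_mul_of_nonneg_left (h m hm) hc.le
        _ ≤ _ := hcn m
  · exact ⟨C, fun n hn => h n (hn.elim id fun hpos => by_contra fun he => hodd ⟨n, he, hpos⟩)⟩

theorem exists_tail_bound [Countable G] (hG : IsAmenable G) (hdim : HasFiniteANDim G)
    (hS : IsSymmGenerating S) (hμ : IsSimpleWalk μ) :
    ∃ C : ℝ, 0 < C ∧ ∀ r : ℝ, 0 < r → ∀ n : ℕ, 1 ≤ n → (incrementLaw μ).real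
        {ω | r < wordLength S (position ω n)} ≤ C * n / r ^ 2 := by
  obtain ⟨C, hC, h⟩ := exists_survival_bound hG hdim hS hμ
  refine ⟨2 * C, by positivity, fun r hr n hn => ?_⟩
  have hn1 : (1 : ℝ) ≤ n := by exact_mod_cast hn
  have hx : 0 < C / r ^ 2 := by positivity
  have heq : 2 * C * n / r ^ 2 = (2 * n : ℕ) * (C / r ^ 2) := by push_cast; ring
  rcases le_or_gt (C / r ^ 2) 1 with hle | hgt
  · obtain ⟨h1, -⟩ := h r hr hle n
    have h2 := one_add_mul_le_pow (a := -(C / r ^ 2)) (by linarith) (2 * n)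
    have hmeas : MeasurableSet {ω : ℕ → G | r < wordLength S (position ω n)} :=
      (dependsOnFirst_position n {g | r < wordLength S g}).measurableSet
    have h3 : (incrementLaw μ).real {ω | ∀ k ≤ 2 * n, (wordLength S (position ω k) : ℝ) ≤ r} ≤
        (incrementLaw μ).real {ω | r < wordLength S (position ω n)}ᶜ :=
      measureReal_mono fun ω hω => not_lt.2 (hω n (by omega))
    rw [probReal_compl_eq_one_sub hmeas] at h3
    rw [← sub_eq_add_neg] at h2
    rw [heq]
    linarith
  -- Here the claimed bound exceeds 1.
  · refine measureReal_le_one.trans ?_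
    rw [heq]
    push_cast
    nlinarith

theorem isDiffusive [Countable G] (hG : IsAmenable G) (hdim : HasFiniteANDim G)
    (hS : IsSymmGenerating S) (hμ : IsSimpleWalk μ) : IsDiffusive S μ := by
  obtain ⟨C, hC, h⟩ := exists_tail_bound hG hdim hS hμ
  -- The part below `√n` contributes 1; the dyadic shells contribute `∑ 8C 2^(-k) = 16C`, in units
  -- of `√n`.
  refine ⟨1 + 16 * C, by positivity, fun n => ?_⟩
  rcases Nat.eq_zero_or_pos n with rfl | hn
  · simp [drift, position]
  have hn0 : (0 : ℝ) < n := by exact_mod_cast hn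
  set r : ℝ := √n
  have hr : 0 < r := Real.sqrt_pos.2 hn0
  have hr2 : r ^ 2 = n := Real.sq_sqrt hn0.le
  let A : ℕ → Set (ℕ → G) := fun k => {ω | 2 ^ k * r ≤ wordLength S (position ω n)}
  have hA : ∀ k, MeasurableSet (A k) := fun k =>
    (dependsOnFirst_position n {g | 2 ^ k * r ≤ wordLength S g}).measurableSet
  have hpt : ∀ ω : ℕ → G, (wordLength S (position ω n) : ℝ≥0∞) ≤
      ENNReal.ofReal r + ∑' k, (A k).indicator (fun _ => ENNReal.ofReal (2 ^ (k + 1) * r)) ω := by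
    intro ω
    rw [← ENNReal.ofReal_natCast]
    rcases le_or_gt ((wordLength S (position ω n) : ℝ) / r) 1 with hle | hgt
    · rw [div_le_one hr] at hle
      exact (ENNReal.ofReal_le_ofReal hle).trans le_self_add
    · obtain ⟨k, hk1, hk2⟩ := exists_nat_pow_near hgt.le one_lt_two
      rw [le_div_iff₀ hr] at hk1
      rw [div_lt_iff₀ hr] at hk2
      refine le_trans ?_ (le_add_self)
      refine le_trans ?_ (ENNReal.le_tsum k)
      rw [Set.indicator_of_mem (show ω ∈ A k from hk1)]
      exact ENNReal.ofReal_le_ofReal hk2.le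
  have hterm : ∀ k, ENNReal.ofReal (2 ^ (k + 1) * r) * incrementLaw μ (A k) ≤
      ENNReal.ofReal (8 * C * r * (1 / 2) ^ k) := by
    intro k
    rw [← ofReal_measureReal, ← ENNReal.ofReal_mul (by positivity)]
    refine ENNReal.ofReal_le_ofReal ?_
    -- Halving the radius turns the weak inequality defining `A k` into the strict one of the tail
    -- bound.
    have h1 : (incrementLaw μ).real (A k) ≤ C * n / (2 ^ k * r / 2) ^ 2 := by
      refine le_trans (measureReal_mono fun ω hω => ?_) (h (2 ^ k * r / 2) (by positivity) n hn)
      have h2 : 2 ^ k * r ≤ wordLength S (position ω n) := hω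
      have h3 : 0 < 2 ^ k * r := by positivity
      change 2 ^ k * r / 2 < wordLength S (position ω n)
      linarith
    calc 2 ^ (k + 1) * r * (incrementLaw μ).real (A k)
        ≤ 2 ^ (k + 1) * r * (C * n / (2 ^ k * r / 2) ^ 2) := by gcongr
      _ = 8 * C * r * (1 / 2) ^ k := by
          rw [← hr2, one_div, inv_pow, pow_succ]
          field_simp
          norm_num
  calc drift S μ n ≤ ∫⁻ ω, (ENNReal.ofReal r +
        ∑' k, (A k).indicator (fun _ => ENNReal.ofReal (2 ^ (k + 1) * r)) ω) ∂incrementLaw μ :=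
        lintegral_mono hpt
    _ = ENNReal.ofReal r + ∑' k, ENNReal.ofReal (2 ^ (k + 1) * r) * incrementLaw μ (A k) := by
        rw [lintegral_add_left measurable_const, lintegral_const, measure_univ, mul_one,
          lintegral_tsum fun k => (measurable_const.indicator (hA k)).aemeasurable]
        simp only [lintegral_indicator_const (hA _)]
    _ ≤ ENNReal.ofReal r + ∑' k : ℕ, ENNReal.ofReal (8 * C * r * (1 / 2) ^ k) :=
        add_le_add_right (ENNReal.tsum_le_tsum hterm) _
    _ = ENNReal.ofReal ((1 + 16 * C) * r) := by
        rw [← ENNReal.ofReal_tsum_of_nonneg (fun k => by positivity)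
          (summable_geometric_two.mul_left _), tsum_mul_left, tsum_geometric_two,
          ← ENNReal.ofReal_add (by positivity) (by positivity)]
        congr 1
        ring

end ANGroup

theorem mainTheorem5 {G : Type*} [Group G] [MeasurableSpace G] [DiscreteMeasurableSpace G]
    (hamen : ANGroup.IsAmenable G) (hdim : ANGroup.HasFiniteANDim G)
    (S : Finset G) (hS : ANGroup.IsSymmGenerating S)
    (μ : PMF G) (hμ : ANGroup.IsSimpleWalk μ) :
    (∀ p : ℝ, 1 ≤ p → p ≤ 2 →
      ∃ C : ℝ, ∀ r : ℝ, 0 < r → ANGroup.lpProfile S μ p r ≤ C * r ^ (-p)) ∧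
    ANGroup.IsTotallyCautious S μ ∧
    (∃ C : ℝ, ∀ n : ℕ, (Even n ∨ 0 < ANGroup.returnProb μ n) →
      Real.exp (-C * (n : ℝ) ^ (1 / 3 : ℝ)) ≤ ANGroup.returnProb μ n) ∧
    ANGroup.IsDiffusive S μ := by
  have := hS.countable
  refine ⟨fun p hp _ => ?_, ANGroup.isTotallyCautious hamen hdim hS hμ,
    ANGroup.exists_returnProb_ge hamen hdim hS hμ, ANGroup.isDiffusive hamen hdim hS hμ⟩
  obtain ⟨C, -, h⟩ := ANGroup.exists_energy_le hamen hdim hS hμ.finite_support (p := p)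
    (by linarith)
  refine ⟨C, fun r hr => ?_⟩
  obtain ⟨f, hf, h1, hE⟩ := h r hr
  exact (ANGroup.lpProfile_le hf h1).trans hE
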